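/- Let $\Omega\subset\mathbb{R}^n$ be a bounded open set with $C^{1,1}$ boundary and let $M\in\mathbb{R}^{n\times n}$. Let $\theta_c,\theta\in[0,\infty)$, $\alpha:[0,\infty)\to[0,\infty)$, and let $U_1(\cdot),\dots,U_m(\cdot)$ be functions on $[0,\infty)$ with values in the symmetric real $n\times n$ matrices. Set $$K=K(\theta)=\begin{cases}\alpha(\theta)\,SO(n) & \text{if }\theta>\theta_c,\\ \bigcup_{j=1}^m SO(n)\,U_j(\theta) & \text{if }\theta\le\theta_c.\end{cases}$$ For $\epsilon>0$ let $$E_\epsilon=\min\Big\{\int_\Omega \operatorname{dist}^2(\nabla u,K)\,dx+\epsilon^2\int_\Omega|\nabla^2u|^2\,dx\Big\},$$ where the minimum is over all weakly differentiable $u:\mathbb{R}^n\to\mathbb{R}^n$ with $\nabla u=M$ a.e. in $\mathbb{R}^n\setminus\overline\Omega$ which have a weak second gradient $\nabla^2u$ in $\Omega$. Assume that there are constants $C>1$, $\epsilon_0>0$ and $\mu\in(0,\tfrac12)$ such that $$\epsilon^{2\mu}\le C\,E_\epsilon\qquad\text{for all }\epsilon\in(0,\epsilon_0).$$ Let $u:\mathbb{R}^n\to\mathbb{R}^n$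 be weakly differentiable with $\nabla u\in K$ a.e. in $\Omega$ and $\nabla u=M$ a.e. in $\mathbb{R}^n\setminus\overline\Omega$. If for some $b\in\mathbb{R}^n$ and $s\in\mathbb{R}$ the function $v(x)=u(x)-Mx-b$ satisfies $v\in H^{1+s}(\mathbb{R}^n)$ (the $L^2$-based Sobolev space defined through the Fourier transform), $\operatorname{supp}v\subset\overline\Omega$ and $\nabla v\in L^\infty(\mathbb{R}^n)$, then $s\le\mu$. -/

import Mathlib

open MeasureTheory Set
open scoped ENNReal NNReal ContDiff Matrix SchwartzMap

attribute [local instance] Matrix.frobeniusNormedAddCommGroup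

noncomputable section

namespace Wells

/-- Euclidean space `ℝⁿ`. -/
abbrev E (n : ℕ) : Type := EuclideanSpace ℝ (Fin n)

/-- Real `n × n` matrices; distances and norms are those of the Frobenius norm. -/
abbrev Mat (n : ℕ) : Type := Matrix (Fin n) (Fin n) ℝ

/-- Open sets with `C^{1,1}` boundary: near each boundary point `Ω` is, for some unit vector `ν`,
the strict epigraph in direction `ν` of a differentiable function with Lipschitz derivative
on the hyperplane orthogonal to `ν`. -/
def HasC11Boundary {n : ℕ} (Ω : Set (E n)) : Prop :=
  ∀ x₀ ∈ frontier Ω, ∃ ν : E n, ‖ν‖ = 1 ∧ ∃ r : ℝ, 0 < r ∧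
    ∃ γ : ((ℝ ∙ ν)ᗮ : Submodule ℝ (E n)) → ℝ,
      Differentiable ℝ γ ∧ (∃ L : ℝ≥0, LipschitzWith L (fderiv ℝ γ)) ∧
      ∀ y ∈ Metric.ball x₀ r,
        (y ∈ Ω ↔ γ ((ℝ ∙ ν)ᗮ.orthogonalProjectionOnto y) < inner ℝ ν y)

/-- `g` is the weak partial derivative `∂ⱼ f` on the open set `U`. -/
def HasWeakPartialOn {n : ℕ} (U : Set (E n)) (j : Fin n) (f g : E n → ℝ) : Prop :=
  LocallyIntegrableOn f U ∧ LocallyIntegrableOn g U ∧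
    ∀ φ : E n → ℝ, ContDiff ℝ ∞ φ → HasCompactSupport φ → tsupport φ ⊆ U →
      ∫ x, f x * fderiv ℝ φ x (EuclideanSpace.single j 1) = -∫ x, g x * φ x

/-- `G` is the weak gradient of the vector field `u` on `U`: `Gᵢⱼ = ∂ⱼ uᵢ`. -/
def HasWeakGradientOn {n : ℕ} (U : Set (E n)) (u : E n → E n) (G : E n → Mat n) : Prop :=
  ∀ i j, HasWeakPartialOn U j (fun x => u x i) (fun x => G x i j)

/-- `H` is the weak gradient of the matrix field `G` on `U`: `Hᵢⱼₖ = ∂ₖ Gᵢⱼ`. -/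
def HasWeakMatrixGradientOn {n : ℕ} (U : Set (E n)) (G : E n → Mat n)
    (H : E n → Fin n → Fin n → Fin n → ℝ) : Prop :=
  ∀ i j k, HasWeakPartialOn U k (fun x => G x i j) (fun x => H x i j k)

/-- The wells at temperature `θ`: `α(θ) SO(n)` above the transformation temperature `θc`, and
`SO(n) U₁(θ) ∪ … ∪ SO(n) Uₘ(θ)` at or below it. -/
def wells {n m : ℕ} (α : ℝ≥0 → ℝ≥0) (U : Fin m → ℝ≥0 → Mat n) (θc θ : ℝ≥0) : Set (Mat n) :=
  if θc < θ then {A | ∃ Q ∈ Matrix.specialOrthogonalGroup (Fin n) ℝ, A = (α θ : ℝ) • Q}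
  else {A | ∃ j : Fin m, ∃ Q ∈ Matrix.specialOrthogonalGroup (Fin n) ℝ, A = Q * U j θ}

/-- `u` is weakly differentiable on `ℝⁿ` with gradient `G`, the gradient is `M` a.e. outside the
closure of `Ω`, and `H` is the weak second gradient of `u` in `Ω`. -/
def IsCompetitor {n : ℕ} (Ω : Set (E n)) (M : Mat n) (u : E n → E n) (G : E n → Mat n)
    (H : E n → Fin n → Fin n → Fin n → ℝ) : Prop :=
  HasWeakGradientOn univ u G ∧ (∀ᵐ x ∂volume.restrict (closure Ω)ᶜ, G x = M) ∧
    HasWeakMatrixGradientOn Ω G H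

/-- `∫_Ω dist²(G, K) + ε² ∫_Ω |H|²`, possibly infinite. -/
def energy {n : ℕ} (Ω : Set (E n)) (K : Set (Mat n)) (ε : ℝ) (G : E n → Mat n)
    (H : E n → Fin n → Fin n → Fin n → ℝ) : ℝ≥0∞ :=
  (∫⁻ x in Ω, Metric.infEDist (G x) K ^ 2) +
    ENNReal.ofReal (ε ^ 2) * ∫⁻ x in Ω, ∑ i, ∑ j, ∑ k, ENNReal.ofReal (H x i j k ^ 2)

/-- The minimal energy `E_ε`. -/
def minEnergy {n : ℕ} (Ω : Set (E n)) (K : Set (Mat n)) (M : Mat n) (ε : ℝ) : ℝ≥0∞ :=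
  ⨅ (u : E n → E n) (G : E n → Mat n) (H : E n → Fin n → Fin n → Fin n → ℝ)
    (_ : IsCompetitor Ω M u G H), energy Ω K ε G H

/-- The locally integrable vector field `v` lies in `H^s(ℝⁿ)`: each component is, as a
distribution, a tempered distribution in the Bessel potential space of order `s`. -/
def MemHs {n : ℕ} (s : ℝ) (v : E n → E n) : Prop :=
  LocallyIntegrable v ∧ ∀ i, ∃ T : 𝓢'(E n, ℂ),
    (∀ φ : 𝓢(E n, ℂ), HasCompactSupport φ → T φ = ∫ x, φ x * ((v x i : ℝ) : ℂ)) ∧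
    TemperedDistribution.MemSobolev s 2 T

/-- The shifted field `x ↦ u(x) - M x - b`. -/
def shifted {n : ℕ} (u : E n → E n) (M : Mat n) (b : E n) (x : E n) : E n :=
  u x - WithLp.toLp 2 (M *ᵥ x.ofLp) - b

end Wells

end

/-! The regularity of `v` is converted into an upper bound `E_ε ≤ A ε^{2s}`, which contradicts the
lower bound `ε^{2μ} ≤ C E_ε` as `ε → 0` when `s > μ`. Since `μ < 1/2`, the exponent `s` may first be
lowered to `min s (1/2)`, which still exceeds `μ`.

The competitor is `Mx + η (v * ρ)`, where `ρ` is a mollifier at scale `ε` and `η` is a smooth cutoff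
that vanishes within `ε` of the complement of `Ω` and equals one at distance at least `3ε` from it.
Since `Du` lies in `K` a.e. in `Ω`, the distance of the competitor's gradient to `K` is at most its
distance to `Du = M + Dv`. Away from the boundary layer this distance is the mollification error of
`Dv`, and the second gradient is `Dv * ∇ρ`.

Both are Fourier multipliers acting on `Dv`, with symbols bounded by constant multiples of `min 1
(ε|ξ|)` and `ε⁻¹ min 1 (ε|ξ|)`. As `min 1 t ≤ t^s` for `0 ≤ s ≤ 1`, the `H^s` bound on `Dv` makes
their weighted squared `L²` norms `O(ε^{2s})` (`lintegral_enorm_sq_le_of_fourier`,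
`lintegral_conv_sub_sq_le`, `lintegral_conv_sq_le`).

In the boundary layer the derivatives of `η` cost `ε⁻¹` and `ε⁻²`, but `v` vanishes outside `closure
Ω` and has bounded gradient, so `|v * ρ| = O(ε)` there (`ae_abs_le_dist`,
`abs_conv_le_of_mem_boundaryLayer`). The extra gradient is therefore bounded and the extra second
gradient is `O(1/ε)`. The layer has volume `O(ε)` (`HasC11Boundary.volume_thickening_le`), so it
contributes `O(ε)` to the energy, which is at most `O(ε^{2s})` because `s ≤ 1/2`. The estimates are
assembled in `exists_minEnergy_le`. -/

set_option linter.unusedSectionVars false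

noncomputable section

namespace Wells

/-! ### Plancherel's identity, Bessel potential norms and multiplier bounds. -/

section Fourier

open FourierTransform TemperedDistribution LineDeriv
open scoped Convolution

variable {V : Type*} [NormedAddCommGroup V] [InnerProductSpace ℝ V] [FiniteDimensional ℝ V]
  [MeasurableSpace V] [BorelSpace V]

/-- Two locally integrable functions are a.e. equal if they define the same distribution. -/
theorem ae_eq_of_integral_schwartz_eq {f g : V → ℂ} (hf : LocallyIntegrable f)
    (hg : LocallyIntegrable g)
    (h : ∀ φ : 𝓢(V, ℂ), HasCompactSupport φ → ∫ x, φ x * f x = ∫ x, φ x * g x) :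
    f =ᵐ[volume] g := by
  refine ae_eq_of_integral_contDiff_smul_eq hf hg fun φ hφ hc => ?_
  have hc₁ : HasCompactSupport (Complex.ofRealCLM ∘ φ) := hc.comp_left rfl
  have hc₂ : ContDiff ℝ ∞ (Complex.ofRealCLM ∘ φ) := by fun_prop
  have := h (hc₁.toSchwartzMap hc₂) hc₁
  simpa using this

/-- Tested against Schwartz functions, both transforms can be moved onto the test function: for the
`L²` transform through tempered distributions, for the integral by Fubini. This permits pointwise
symbol estimates together with Plancherel's identity. -/
theorem fourier_toLp_ae_eq {w : V → ℂ} (h1 : Integrable w) (h2 : MemLp w 2) :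
    (𝓕 (h2.toLp w) : Lp ℂ 2 (volume : Measure V)) =ᵐ[volume] 𝓕 w := by
  have hcont : Continuous (𝓕 w) :=
    VectorFourier.fourierIntegral_continuous Real.continuous_fourierChar
      (by exact continuous_inner) h1
  refine ae_eq_of_integral_schwartz_eq ((Lp.memLp _).locallyIntegrable (by norm_num))
    hcont.locallyIntegrable fun φ _ => ?_
  have e1 : ∫ x, φ x * (𝓕 (h2.toLp w) : Lp ℂ 2 (volume : Measure V)) x
      = ((𝓕 (h2.toLp w) : Lp ℂ 2 (volume : Measure V)) : 𝓢'(V, ℂ)) φ := by simp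
  rw [e1, ← Lp.fourier_toTemperedDistribution_eq, TemperedDistribution.fourier_apply,
    Lp.toTemperedDistribution_apply]
  have e2 : ∫ x, (𝓕 φ) x • (h2.toLp w) x = ∫ x, (𝓕 (φ : V → ℂ)) x • w x := by
    apply integral_congr_ae
    filter_upwards [h2.coeFn_toLp] with x hx
    rw [hx]; rfl
  rw [e2]
  simpa using! (VectorFourier.integral_fourierIntegral_smul_eq_flip (L := innerₗ V)
    Real.continuous_fourierChar continuous_inner φ.integrable h1)

theorem lintegral_enorm_fourier_sq {w : V → ℂ} (h1 : Integrable w) (h2 : MemLp w 2) :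
    ∫⁻ x, ‖w x‖ₑ ^ 2 = ∫⁻ ξ, ‖𝓕 w ξ‖ₑ ^ 2 := by
  have key : ∀ f : V → ℂ, ∫⁻ x, ‖f x‖ₑ ^ 2 = eLpNorm f 2 volume ^ 2 := fun f => by
    have := eLpNorm_nnreal_pow_eq_lintegral (f := f) (μ := (volume : Measure V)) (p := 2)
      (by norm_num)
    simpa using this.symm
  rw [key, key, ← eLpNorm_congr_ae (fourier_toLp_ae_eq h1 h2), ← eLpNorm_congr_ae h2.coeFn_toLp]
  have := Lp.norm_fourier_eq (h2.toLp w)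
  have h := congrArg ENNReal.ofReal this
  rw [Lp.norm_def, Lp.norm_def, ENNReal.ofReal_toReal (Lp.memLp _).2.ne,
    ENNReal.ofReal_toReal (Lp.memLp _).2.ne] at h
  rw [h]

/-- The Bessel potential norm of an integrable `L²` function that represents, against compactly
supported test functions, a tempered distribution in `H^s`, is given by its Fourier integral. -/
theorem lintegral_weight_fourier_lt_top {s : ℝ} (hs : 0 ≤ s) {w : V → ℂ} (h1 : Integrable w)
    (h2 : MemLp w 2) {T : 𝓢'(V, ℂ)} (hT : MemSobolev s 2 T)
    (hw : ∀ φ : 𝓢(V, ℂ), HasCompactSupport φ → T φ = ∫ x, φ x * w x) :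
    ∫⁻ ξ, ENNReal.ofReal ((1 + ‖ξ‖ ^ 2) ^ s) * ‖𝓕 w ξ‖ₑ ^ 2 < ⊤ := by
  -- As `s ≥ 0`, `T` is an `L²` function; compactly supported tests already identify it with `w`, so
  -- `T` is known on every Schwartz function.
  obtain ⟨f, hf⟩ := memSobolev_zero_iff.1 (hT.mono hs)
  have hfw : f =ᵐ[volume] w := by
    refine ae_eq_of_integral_schwartz_eq ((Lp.memLp _).locallyIntegrable (by norm_num))
      h1.locallyIntegrable fun φ hφ => ?_
    rw [← hw φ hφ, hf]; simp
  have hfe : f = h2.toLp w := by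
    rw [← Lp.toLp_coeFn f (Lp.memLp f)]
    exact (MemLp.toLp_eq_toLp_iff _ _).2 hfw
  obtain ⟨g, hg⟩ := memSobolev_iff_exists_smulLeftCLM_fourier.1 hT
  have hcont : Continuous (𝓕 w) :=
    VectorFourier.fourierIntegral_continuous Real.continuous_fourierChar
      (by exact continuous_inner) h1
  have hwt : Continuous fun ξ : V => ((1 + ‖ξ‖ ^ 2) ^ (s / 2) : ℝ) :=
    Continuous.rpow_const (by fun_prop) fun x => Or.inl (by positivity)
  have hgt : Function.HasTemperateGrowth
      (fun ξ : V => (((1 + ‖ξ‖ ^ 2) ^ (s / 2) : ℝ) : ℂ)) := by fun_prop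
  have hge : g =ᵐ[volume] fun ξ => (((1 + ‖ξ‖ ^ 2) ^ (s / 2) : ℝ) : ℂ) * 𝓕 w ξ := by
    refine ae_eq_of_integral_schwartz_eq ((Lp.memLp _).locallyIntegrable (by norm_num))
      (Continuous.locallyIntegrable (by fun_prop)) fun φ hφ => ?_
    have e1 : ∫ x, φ x * g x = (g : 𝓢'(V, ℂ)) φ := by simp
    rw [e1, ← hg, smulLeftCLM_apply_apply, hf, hfe, Lp.fourier_toTemperedDistribution_eq,
      Lp.toTemperedDistribution_apply]
    apply integral_congr_ae
    filter_upwards [fourier_toLp_ae_eq h1 h2] with x hx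
    rw [hx, SchwartzMap.smulLeftCLM_apply_apply hgt]
    simp only [smul_eq_mul]; ring
  have hgfin : ∫⁻ ξ, ‖g ξ‖ₑ ^ 2 < ⊤ := by
    have := eLpNorm_nnreal_pow_eq_lintegral (f := g) (μ := (volume : Measure V)) (p := 2)
      (by norm_num)
    have h' : ∫⁻ ξ, ‖g ξ‖ₑ ^ 2 = eLpNorm g 2 volume ^ 2 := by simpa using this.symm
    rw [h']
    exact ENNReal.pow_lt_top (Lp.memLp g).2
  refine lt_of_le_of_lt (le_of_eq (lintegral_congr_ae ?_)) hgfin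
  filter_upwards [hge] with ξ hξ
  rw [hξ, enorm_mul, mul_pow]
  congr 1
  rw [← ofReal_norm, ← ENNReal.ofReal_pow (norm_nonneg _), Complex.norm_real, Real.norm_eq_abs,
    sq_abs, ← Real.rpow_mul_natCast (by positivity)]
  congr 2
  norm_num

/-- An `L²` bound for a function whose Fourier transform is controlled by that of an
`H^s` function at frequencies below `1 / ε`. -/
theorem lintegral_enorm_sq_le_of_fourier {s ε A : ℝ} (hs : 0 ≤ s) (hs1 : s ≤ 1) (hε : 0 < ε)
    {w h : V → ℂ} (h1 : Integrable h) (h2 : MemLp h 2)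
    (hb : ∀ ξ, ‖𝓕 h ξ‖ ≤ A * min 1 (ε * ‖ξ‖) * ‖𝓕 w ξ‖) :
    ∫⁻ x, ‖h x‖ₑ ^ 2 ≤ ENNReal.ofReal (A ^ 2 * ε ^ (2 * s)) *
      ∫⁻ ξ, ENNReal.ofReal ((1 + ‖ξ‖ ^ 2) ^ s) * ‖𝓕 w ξ‖ₑ ^ 2 := by
  rw [lintegral_enorm_fourier_sq h1 h2, ← lintegral_const_mul' _ _ ENNReal.ofReal_ne_top]
  refine lintegral_mono fun ξ => ?_
  -- The elementary inequality `min 1 t ≤ t^s`, valid for `0 ≤ s ≤ 1`, is what turns the symbol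
  -- bound into a power of `ε`.
  have hmin : min 1 (ε * ‖ξ‖) ^ 2 ≤ ε ^ (2 * s) * (1 + ‖ξ‖ ^ 2) ^ s := by
    have h0 : 0 ≤ ε * ‖ξ‖ := by positivity
    have : min 1 (ε * ‖ξ‖) ≤ (ε * ‖ξ‖) ^ s := by
      rcases le_total 1 (ε * ‖ξ‖) with h | h
      · rw [min_eq_left h]; exact Real.one_le_rpow h hs
      · rw [min_eq_right h]
        simpa using Real.rpow_le_rpow_of_exponent_ge' h0 h hs hs1
    calc min 1 (ε * ‖ξ‖) ^ 2 ≤ ((ε * ‖ξ‖) ^ s) ^ 2 := by gcongr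
      _ = ε ^ (2 * s) * (‖ξ‖ ^ 2) ^ s := by
        rw [Real.mul_rpow hε.le (norm_nonneg _), mul_pow, mul_comm 2 s, Real.rpow_mul hε.le,
          ← Real.rpow_natCast, ← Real.rpow_natCast, ← Real.rpow_natCast, ← Real.rpow_mul
          (norm_nonneg _), ← Real.rpow_mul (norm_nonneg _), mul_comm s]
        norm_num
      _ ≤ _ := by gcongr; linarith
  calc ‖𝓕 h ξ‖ₑ ^ 2 = ENNReal.ofReal (‖𝓕 h ξ‖ ^ 2) := by
        rw [← ofReal_norm, ENNReal.ofReal_pow (norm_nonneg _)]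
    _ ≤ ENNReal.ofReal (A ^ 2 * ε ^ (2 * s) * ((1 + ‖ξ‖ ^ 2) ^ s * ‖𝓕 w ξ‖ ^ 2)) := by
        apply ENNReal.ofReal_le_ofReal
        calc ‖𝓕 h ξ‖ ^ 2 ≤ (A * min 1 (ε * ‖ξ‖) * ‖𝓕 w ξ‖) ^ 2 := by gcongr; exact hb ξ
          _ = A ^ 2 * min 1 (ε * ‖ξ‖) ^ 2 * ‖𝓕 w ξ‖ ^ 2 := by ring
          _ ≤ A ^ 2 * (ε ^ (2 * s) * (1 + ‖ξ‖ ^ 2) ^ s) * ‖𝓕 w ξ‖ ^ 2 := by gcongr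
          _ = _ := by ring
    _ = _ := by
        rw [ENNReal.ofReal_mul (by positivity), ENNReal.ofReal_mul (by positivity),
          ENNReal.ofReal_mul (by positivity), ENNReal.ofReal_pow (norm_nonneg (𝓕 w ξ)), ofReal_norm]

/-- The oscillation of the Fourier transform of a function supported in the `ε`-ball. -/
theorem norm_fourier_sub_integral_le {ε : ℝ} {ψ : V → ℂ} (hψ : Integrable ψ)
    (hsupp : ∀ x, ε ≤ ‖x‖ → ψ x = 0) (ξ : V) :
    ‖𝓕 ψ ξ - ∫ x, ψ x‖ ≤ 2 * Real.pi * (∫ x, ‖ψ x‖) * min 1 (ε * ‖ξ‖) := by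
  have hint : Integrable fun x => Real.fourierChar (-inner ℝ x ξ) • ψ x := by
    refine hψ.mono ?_ (.of_forall fun x => by simp [Circle.norm_smul])
    have : Continuous fun x : V => (Real.fourierChar (-inner ℝ x ξ) : ℂ) := by fun_prop
    exact this.aestronglyMeasurable.smul hψ.aestronglyMeasurable
  rw [Real.fourier_eq, ← integral_sub hint hψ, mul_assoc, mul_comm (∫ x, ‖ψ x‖), ← mul_assoc,
    ← integral_const_mul]
  refine norm_integral_le_of_norm_le (hψ.norm.const_mul _) (.of_forall fun x => ?_)
  have e : Real.fourierChar (-inner ℝ x ξ) • ψ x - ψ x =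
      ((Real.fourierChar (-inner ℝ x ξ) : ℂ) - 1) * ψ x := by
    rw [Circle.smul_def, smul_eq_mul]; ring
  rw [e, norm_mul]
  by_cases hx : ε ≤ ‖x‖
  · simp [hsupp x hx]
  push Not at hx
  gcongr
  have hpi := Real.pi_gt_three
  rw [mul_min_of_nonneg _ _ (by positivity)]
  -- High frequencies use `|e^{iθ} - 1| ≤ 2 ≤ 2π`, low ones `|e^{iθ} - 1| ≤ |θ|` with `|θ| ≤ 2π ε
  -- ‖ξ‖`.
  refine le_min ?_ ?_
  · calc ‖(Real.fourierChar (-inner ℝ x ξ) : ℂ) - 1‖ ≤ ‖(Real.fourierChar (-inner ℝ x ξ) : ℂ)‖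
        + ‖(1 : ℂ)‖ := norm_sub_le _ _
      _ = 2 := by rw [Circle.norm_coe, norm_one]; norm_num
      _ ≤ _ := by linarith
  · rw [Real.fourierChar_apply]
    have := Real.norm_exp_I_mul_ofReal_sub_one_le (x := 2 * Real.pi * -inner ℝ x ξ)
    rw [mul_comm Complex.I] at this
    refine this.trans ?_
    rw [Real.norm_eq_abs, abs_mul, abs_neg, abs_of_pos (by positivity : 0 < 2 * Real.pi)]
    gcongr
    exact (abs_real_inner_le_norm x ξ).trans (by gcongr)

end Fourier

/-! ### Convolution with smooth kernels and scaling of mollifiers. -/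

section Mollification

variable {V : Type*} [NormedAddCommGroup V] [InnerProductSpace ℝ V] [FiniteDimensional ℝ V]
  [MeasurableSpace V] [BorelSpace V]

/-- Convolution of real functions with respect to Lebesgue measure. -/
def conv (f φ : V → ℝ) : V → ℝ :=
  MeasureTheory.convolution f φ (ContinuousLinearMap.mul ℝ ℝ) volume

theorem conv_apply (f φ : V → ℝ) (x : V) : conv f φ x = ∫ y, f y * φ (x - y) := rfl

theorem contDiff_conv {f φ : V → ℝ} (hf : LocallyIntegrable f) (hφ : ContDiff ℝ ∞ φ)
    (hc : HasCompactSupport φ) : ContDiff ℝ ∞ (conv f φ) :=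
  hc.contDiff_convolution_right _ hf hφ

theorem contDiff_fderiv_apply {φ : V → ℝ} (hφ : ContDiff ℝ ∞ φ) (e : V) :
    ContDiff ℝ ∞ fun x => fderiv ℝ φ x e :=
  (hφ.fderiv_right (m := ∞) (by simp)).clm_apply contDiff_const

theorem hasCompactSupport_fderiv_apply {φ : V → ℝ} (hc : HasCompactSupport φ) (e : V) :
    HasCompactSupport fun x => fderiv ℝ φ x e :=
  (hc.fderiv ℝ).comp_left (g := fun L : V →L[ℝ] ℝ => L e) rfl

theorem fderiv_conv {f φ : V → ℝ} (hf : LocallyIntegrable f) (hφ : ContDiff ℝ ∞ φ)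
    (hc : HasCompactSupport φ) (x e : V) :
    fderiv ℝ (conv f φ) x e = conv f (fun z => fderiv ℝ φ z e) x := by
  have h := hc.hasFDerivAt_convolution_right (ContinuousLinearMap.mul ℝ ℝ) hf
    (hφ.of_le (by simp)) x
  have h' : HasFDerivAt (conv f φ) _ x := h
  rw [h'.fderiv]
  have hex := (hc.fderiv ℝ).convolutionExists_right
    ((ContinuousLinearMap.mul ℝ ℝ).precompR V) hf (hφ.continuous_fderiv (by simp)) x
  rw [convolution_def, ContinuousLinearMap.integral_apply hex]
  rfl

/-- Strictly outside the `ε`-ball `φ` is locally zero; a point on the sphere is a radial limit of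
such points, and the derivative is continuous. If `x = 0`, then `ε ≤ 0` and `φ` vanishes everywhere.
Derivatives of a mollifier thus satisfy the same closed support condition. -/
theorem fderiv_eq_zero_of_forall_le_norm {φ : V → ℝ} {ε : ℝ} (hφ : ContDiff ℝ ∞ φ)
    (h : ∀ x, ε ≤ ‖x‖ → φ x = 0) (x : V) (hx : ε ≤ ‖x‖) (e : V) : fderiv ℝ φ x e = 0 := by
  have hcont : Continuous fun y => fderiv ℝ φ y e := (contDiff_fderiv_apply hφ e).continuous
  by_cases hx0 : x = 0
  · have : ∀ y, φ y = 0 := fun y => h y (hx.trans (by simp [hx0]))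
    rw [show φ = fun _ => 0 from funext this]
    simp
  have hlim : Filter.Tendsto (fun t : ℝ => fderiv ℝ φ ((1 + t) • x) e)
      (nhdsWithin 0 (Ioi 0)) (nhds (fderiv ℝ φ x e)) := by
    have : Continuous fun t : ℝ => fderiv ℝ φ ((1 + t) • x) e :=
      hcont.comp (by fun_prop)
    simpa using (this.tendsto 0).mono_left nhdsWithin_le_nhds
  refine tendsto_nhds_unique hlim (tendsto_const_nhds.congr' ?_)
  filter_upwards [self_mem_nhdsWithin] with t ht
  have hpos : 0 < ‖x‖ := norm_pos_iff.2 hx0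
  have hlt : ε < ‖(1 + t) • x‖ := by
    rw [norm_smul, Real.norm_eq_abs, abs_of_pos (by linarith [mem_Ioi.1 ht] : 0 < 1 + t)]
    nlinarith [mem_Ioi.1 ht]
  have : φ =ᶠ[nhds ((1 + t) • x)] fun _ => 0 := by
    filter_upwards [continuous_norm.continuousAt.eventually (lt_mem_nhds hlt)] with y hy
    exact h y hy.le
  rw [this.fderiv_eq]; simp

/-- Only the values of `f` within `ε` of `x` enter, so a local bound suffices; near the boundary
this exploits the smallness of `v`. -/
theorem abs_conv_le {f φ : V → ℝ} {ε B : ℝ} (hφ : Continuous φ)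
    (hc : HasCompactSupport φ) (h : ∀ x, ε ≤ ‖x‖ → φ x = 0) {x : V}
    (hB : ∀ᵐ y, y ∈ Metric.ball x ε → |f y| ≤ B) :
    |conv f φ x| ≤ B * ∫ y, |φ y| := by
  have hi : Integrable fun y => |φ (x - y)| :=
    ((hφ.integrable_of_hasCompactSupport hc).comp_sub_left x).abs
  rw [conv_apply, ← integral_sub_left_eq_self (fun y => |φ y|) volume x, ← integral_const_mul,
    ← Real.norm_eq_abs]
  refine norm_integral_le_of_norm_le (hi.const_mul B) ?_
  filter_upwards [hB] with y hy
  rw [norm_mul, Real.norm_eq_abs, Real.norm_eq_abs]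
  by_cases hxy : ε ≤ ‖x - y‖
  · simp [h _ hxy]
  · gcongr
    exact hy (by rw [Metric.mem_ball, dist_comm, dist_eq_norm]; exact not_le.1 hxy)

theorem conv_eq_const {f φ : V → ℝ} {ε c : ℝ} (h : ∀ x, ε ≤ ‖x‖ → φ x = 0) {x : V}
    (hc : ∀ᵐ y, y ∈ Metric.ball x ε → f y = c) : conv f φ x = c * ∫ y, φ y := by
  rw [conv_apply, ← integral_sub_left_eq_self φ volume x, ← integral_const_mul]
  refine integral_congr_ae ?_
  filter_upwards [hc] with y hy
  by_cases hxy : ε ≤ ‖x - y‖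
  · simp [h _ hxy]
  · rw [hy (by rw [Metric.mem_ball, dist_comm, dist_eq_norm]; exact not_le.1 hxy)]

/-- Rescaling of a function that preserves its integral. -/
def rescale (ε : ℝ) (φ : V → ℝ) (x : V) : ℝ := ε⁻¹ ^ Module.finrank ℝ V * φ (ε⁻¹ • x)

theorem integral_rescale {ε : ℝ} (hε : 0 < ε) (φ : V → ℝ) :
    ∫ x, rescale ε φ x = ∫ x, φ x := by
  simp only [rescale]
  rw [integral_const_mul, Measure.integral_comp_smul, smul_eq_mul, ← mul_assoc,
    abs_of_pos (by positivity), mul_inv_cancel₀ (by positivity), one_mul]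

theorem abs_rescale {ε : ℝ} (hε : 0 < ε) (φ : V → ℝ) (x : V) :
    |rescale ε φ x| = rescale ε (fun y => |φ y|) x := by
  simp only [rescale]
  rw [abs_mul, abs_of_pos (by positivity)]

theorem fderiv_rescale {ε : ℝ} {φ : V → ℝ} (hφ : ContDiff ℝ ∞ φ) (x e : V) :
    fderiv ℝ (rescale ε φ) x e = ε⁻¹ * rescale ε (fun y => fderiv ℝ φ y e) x := by
  have h1 : HasFDerivAt φ (fderiv ℝ φ (ε⁻¹ • x)) (ε⁻¹ • x) :=
    (hφ.differentiable (by simp) _).hasFDerivAt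
  have h2 : HasFDerivAt (fun y : V => ε⁻¹ • y) (ε⁻¹ • ContinuousLinearMap.id ℝ V) x :=
    (hasFDerivAt_id x).const_smul ε⁻¹
  have h3 : HasFDerivAt (rescale ε φ) _ x :=
    (h1.comp x h2).const_mul (ε⁻¹ ^ Module.finrank ℝ V)
  rw [h3.fderiv]
  simp [rescale]
  ring

theorem contDiff_rescale {ε : ℝ} {φ : V → ℝ} (hφ : ContDiff ℝ ∞ φ) :
    ContDiff ℝ ∞ (rescale ε φ) :=
  contDiff_const.mul (hφ.comp (contDiff_const_smul _))

/-- The mollification kernels at scale `ε`, with scale-invariant bounds `C` for the first two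
derivatives. -/
structure IsMollifier (C ε : ℝ) (ρ : V → ℝ) : Prop where
  contDiff : ContDiff ℝ ∞ ρ
  hasCompactSupport : HasCompactSupport ρ
  eq_zero : ∀ x, ε ≤ ‖x‖ → ρ x = 0
  nonneg : ∀ x, 0 ≤ ρ x
  integral_eq_one : ∫ x, ρ x = 1
  integral_fderiv : ∀ e : V, ‖e‖ ≤ 1 → ∫ x, |fderiv ℝ ρ x e| ≤ C / ε
  integral_fderiv_fderiv : ∀ e e' : V, ‖e‖ ≤ 1 → ‖e'‖ ≤ 1 →
    ∫ x, |fderiv ℝ (fun y => fderiv ℝ ρ y e) x e'| ≤ C / ε ^ 2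

variable (V) in
-- All kernels are rescalings of one bump of outer radius one. Rescaling preserves the integral, and
-- each derivative costs a factor `ε⁻¹`. The sum of the `L¹` norms of the first two derivatives of
-- the bump serves as a common constant.
theorem exists_isMollifier :
    ∃ C : ℝ, 0 ≤ C ∧ ∀ ε : ℝ, 0 < ε → ∃ ρ : V → ℝ, IsMollifier C ε ρ := by
  let b : ContDiffBump (0 : V) := ⟨1 / 2, 1, by norm_num, by norm_num⟩
  let φ : V → ℝ := b.normed volume
  have hφ : ContDiff ℝ ∞ φ := b.contDiff_normed
  have hc : HasCompactSupport φ := b.hasCompactSupport_normed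
  have hi1 : Integrable fun x => ‖fderiv ℝ φ x‖ :=
    ((hφ.continuous_fderiv (by simp)).integrable_of_hasCompactSupport (hc.fderiv ℝ)).norm
  have hd : ContDiff ℝ ∞ (fderiv ℝ φ) := hφ.fderiv_right (by simp)
  have hi2 : Integrable fun x => ‖fderiv ℝ (fderiv ℝ φ) x‖ :=
    ((hd.continuous_fderiv (by simp)).integrable_of_hasCompactSupport
      ((hc.fderiv ℝ).fderiv ℝ)).norm
  refine ⟨(∫ x, ‖fderiv ℝ φ x‖) + ∫ x, ‖fderiv ℝ (fderiv ℝ φ) x‖, by positivity,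
    fun ε hε => ⟨rescale ε φ, ?_⟩⟩
  have hb1 : ∀ e : V, ‖e‖ ≤ 1 → ∫ x, |fderiv ℝ φ x e| ≤ ∫ x, ‖fderiv ℝ φ x‖ := fun e he => by
    refine integral_mono_of_nonneg (.of_forall fun x => abs_nonneg _) hi1
      (.of_forall fun x => ?_)
    exact ((fderiv ℝ φ x).le_opNorm e).trans (mul_le_of_le_one_right (norm_nonneg _) he)
  have hb2 : ∀ e e' : V, ‖e‖ ≤ 1 → ‖e'‖ ≤ 1 →
      ∫ x, |fderiv ℝ (fun y => fderiv ℝ φ y e) x e'| ≤ ∫ x, ‖fderiv ℝ (fderiv ℝ φ) x‖ :=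
    fun e e' he he' => by
    refine integral_mono_of_nonneg (.of_forall fun x => abs_nonneg _) hi2
      (.of_forall fun x => ?_)
    have h1 : HasFDerivAt (fderiv ℝ φ) (fderiv ℝ (fderiv ℝ φ) x) x :=
      (hd.differentiable (by simp) _).hasFDerivAt
    have h2 := (h1.clm_apply (hasFDerivAt_const e x)).fderiv
    simp only
    rw [h2]
    simp only [ContinuousLinearMap.comp_zero, zero_add, ContinuousLinearMap.flip_apply]
    refine ((fderiv ℝ (fderiv ℝ φ) x e').le_opNorm e).trans ?_
    refine (mul_le_of_le_one_right (norm_nonneg _) he).trans ?_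
    exact ((fderiv ℝ (fderiv ℝ φ) x).le_opNorm e').trans
      (mul_le_of_le_one_right (norm_nonneg _) he')
  have hI1 : 0 ≤ ∫ x, ‖fderiv ℝ φ x‖ := by positivity
  have hI2 : 0 ≤ ∫ x, ‖fderiv ℝ (fderiv ℝ φ) x‖ := by positivity
  refine ⟨contDiff_rescale hφ, ?_, ?_, ?_, ?_, ?_, ?_⟩
  · exact (hc.comp_smul (inv_ne_zero hε.ne')).mul_left
  · intro x hx
    have : φ (ε⁻¹ • x) = 0 := by
      have hns : ε⁻¹ • x ∉ Function.support (b.normed volume) := by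
        rw [b.support_normed_eq, Metric.mem_ball, dist_zero_right, norm_smul, norm_inv,
          Real.norm_of_nonneg hε.le, not_lt]
        change 1 ≤ _
        rw [inv_mul_eq_div, one_le_div hε]
        exact hx
      exact Function.notMem_support.1 hns
    simp [rescale, this]
  · intro x
    have := b.nonneg_normed (μ := volume) (ε⁻¹ • x)
    exact mul_nonneg (by positivity) this
  · rw [integral_rescale hε]; exact b.integral_normed
  · intro e he
    simp_rw [fderiv_rescale hφ, abs_mul, abs_rescale hε]
    rw [integral_const_mul, integral_rescale hε, abs_of_pos (inv_pos.2 hε), inv_mul_eq_div]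
    gcongr
    linarith [hb1 e he]
  · intro e e' he he'
    have hφe := contDiff_fderiv_apply hφ e
    have : ∀ x, fderiv ℝ (fun y => fderiv ℝ (rescale ε φ) y e) x e' =
        ε⁻¹ * (ε⁻¹ * rescale ε (fun y => fderiv ℝ (fun z => fderiv ℝ φ z e) y e') x) := by
      intro x
      simp_rw [fderiv_rescale hφ]
      rw [fderiv_const_mul ((contDiff_rescale hφe).differentiable (by simp) _),
        smul_apply, fderiv_rescale hφe, smul_eq_mul]
    simp_rw [this, abs_mul, abs_rescale hε]
    rw [integral_const_mul, integral_const_mul, integral_rescale hε, abs_of_pos (inv_pos.2 hε),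
      ← mul_assoc, ← sq, inv_pow, inv_mul_eq_div]
    gcongr
    linarith [hb2 e e' he he']

end Mollification

/-! ### Geometry of the boundary and volume of its neighbourhoods. -/

section Boundary

/-- Slabs around a graph have measure at most proportional to their width. -/
theorem volume_slab_le {n : ℕ} {ν : E n} (hν : ‖ν‖ = 1) {f : E n → ℝ} (hf : Continuous f)
    (hfν : ∀ z t, f (z + t • ν) = f z + t) (x₀ : E n) (r : ℝ) {a : ℝ} (ha : 0 < a) :
    volume (Metric.ball x₀ r ∩ {z | |f z| ≤ a}) ≤
      ENNReal.ofReal (3 * a) * volume (Metric.ball x₀ (r + 1)) := by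
  set A : Set (E n) := Metric.ball x₀ r ∩ {z | |f z| ≤ a}
  have hA : MeasurableSet A :=
    measurableSet_ball.inter (isClosed_le hf.abs continuous_const).measurableSet
  -- Translates by multiples of `3a` along `ν` are disjoint because the slab has thickness `2a`. The
  -- number `N` is chosen so that all shifts stay at most one, keeping the translates in the
  -- enlarged ball, while `3aN ≥ 1`.
  set N : ℕ := ⌊1 / (3 * a)⌋₊ + 1
  have hN : 1 ≤ 3 * a * N := by
    have := Nat.lt_floor_add_one (1 / (3 * a))
    rw [div_lt_iff₀ (by positivity)] at this
    push_cast [N]; linarith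
  have hk : ∀ k ∈ Finset.range N, 3 * a * k ≤ 1 := fun k hk => by
    have h1 : k ≤ ⌊1 / (3 * a)⌋₊ := by have := Finset.mem_range.1 hk; omega
    have h2 := (Nat.le_floor_iff (by positivity)).1 h1
    rw [le_div_iff₀ (by positivity)] at h2
    linarith
  let B : ℕ → Set (E n) := fun k => (fun z => z + (-(3 * a * k)) • ν) ⁻¹' A
  have hB : ∀ k, MeasurableSet (B k) := fun k => (measurable_add_const _) hA
  have hvol : ∀ k, volume (B k) = volume A := fun k => measure_preimage_add_right volume _ A
  have hdisj : (Finset.range N : Set ℕ).PairwiseDisjoint B := by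
    intro k _ l _ hkl
    rw [Function.onFun, Set.disjoint_left]
    rintro z ⟨_, hz1⟩ ⟨_, hz2⟩
    simp only [mem_ofPred_eq, hfν, abs_le] at hz1 hz2
    rcases lt_or_gt_of_ne hkl with h | h
    · have : (k : ℝ) + 1 ≤ l := by exact_mod_cast h
      nlinarith
    · have : (l : ℝ) + 1 ≤ k := by exact_mod_cast h
      nlinarith
  have hsub : (⋃ k ∈ Finset.range N, B k) ⊆ Metric.ball x₀ (r + 1) := by
    intro z hz
    simp only [mem_iUnion] at hz
    obtain ⟨k, hkN, hz⟩ := hz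
    have h1 : dist (z + (-(3 * a * k)) • ν) x₀ < r := hz.1
    rw [Metric.mem_ball]
    calc dist z x₀ ≤ dist z (z + (-(3 * a * k)) • ν) + dist (z + (-(3 * a * k)) • ν) x₀ :=
          dist_triangle _ _ _
      _ < _ := by
        have : dist z (z + (-(3 * a * k)) • ν) ≤ 1 := by
          rw [dist_self_add_right, norm_smul, hν, norm_neg, Real.norm_of_nonneg (by positivity)]
          simpa using hk k hkN
        linarith
  have hsum : (N : ℝ≥0∞) * volume A ≤ volume (Metric.ball x₀ (r + 1)) := by
    calc (N : ℝ≥0∞) * volume A = ∑ k ∈ Finset.range N, volume (B k) := by simp [hvol]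
      _ = volume (⋃ k ∈ Finset.range N, B k) :=
        (measure_biUnion_finset hdisj fun k _ => hB k).symm
      _ ≤ _ := measure_mono hsub
  calc volume A ≤ ENNReal.ofReal (3 * a * N) * volume A := by
        refine le_mul_of_one_le_left' ?_
        rw [← ENNReal.ofReal_one]; exact ENNReal.ofReal_le_ofReal hN
    _ = ENNReal.ofReal (3 * a) * (N * volume A) := by
        rw [ENNReal.ofReal_mul (by positivity), ENNReal.ofReal_natCast, mul_assoc]
    _ ≤ _ := by gcongr

/-- A set with `C^{1,1}` boundary is locally a superlevel set of a Lipschitz function that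
increases at unit speed in some direction. -/
theorem HasC11Boundary.exists_chart {n : ℕ} {Ω : Set (E n)} (hΩ : HasC11Boundary Ω)
    {x₀ : E n} (hx₀ : x₀ ∈ frontier Ω) :
    ∃ ν : E n, ‖ν‖ = 1 ∧ ∃ r : ℝ, 0 < r ∧ ∃ f : E n → ℝ, Continuous f ∧
      (∀ z t, f (z + t • ν) = f z + t) ∧
      (∀ y ∈ Metric.ball x₀ r, (y ∈ Ω ↔ 0 < f y)) ∧
      ∃ Λ : ℝ, 0 < Λ ∧ ∀ x ∈ Metric.ball x₀ r, ∀ y ∈ Metric.ball x₀ r,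
        |f x - f y| ≤ Λ * dist x y := by
  obtain ⟨ν, hν, r, hr, γ, hγ, ⟨L, hL⟩, h⟩ := hΩ x₀ hx₀
  set P := (ℝ ∙ ν)ᗮ.orthogonalProjectionOnto
  have hPν : P ν = 0 := by
    rw [Submodule.orthogonalProjectionOnto_eq_zero_iff, Submodule.orthogonal_orthogonal]
    exact Submodule.mem_span_singleton_self ν
  have hPd : ∀ x y, dist (P x) (P y) ≤ dist x y := fun x y => by
    rw [dist_eq_norm, dist_eq_norm, ← map_sub]
    exact Submodule.norm_orthogonalProjectionOnto_apply_le _ _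
  refine ⟨ν, hν, r, hr, fun z => inner ℝ ν z - γ (P z), ?_, ?_, ?_, ?_⟩
  · have := hγ.continuous
    fun_prop
  · intro z t
    simp only [map_add, map_smul, hPν, inner_add_right, inner_smul_right,
      real_inner_self_eq_norm_sq, hν]
    simp; ring
  · intro y hy; rw [h y hy]; exact sub_pos.symm
  -- A Lipschitz derivative is bounded on the ball, by its value at the centre plus `L r`; the mean
  -- value inequality then makes `γ` Lipschitz there.
  · set D : ℝ≥0 := ‖fderiv ℝ γ (P x₀)‖₊ + L * r.toNNReal
    have hD : LipschitzOnWith D γ (Metric.ball (P x₀) r) := by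
      refine (convex_ball _ _).lipschitzOnWith_of_nnnorm_fderiv_le (𝕜 := ℝ)
        (fun x _ => hγ x) fun x hx => ?_
      rw [← NNReal.coe_le_coe]
      push_cast [D]
      have h1 := hL.dist_le_mul x (P x₀)
      rw [dist_eq_norm] at h1
      have h2 : dist x (P x₀) ≤ r.toNNReal := (Metric.mem_ball.1 hx).le.trans
        (Real.le_coe_toNNReal r)
      calc ‖fderiv ℝ γ x‖ ≤ ‖fderiv ℝ γ (P x₀)‖ + ‖fderiv ℝ γ x - fderiv ℝ γ (P x₀)‖ :=
            by simpa using norm_add_le (fderiv ℝ γ (P x₀)) (fderiv ℝ γ x - fderiv ℝ γ (P x₀))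
        _ ≤ _ := by gcongr; exact h1.trans (by gcongr)
    refine ⟨1 + D, by positivity, fun x hx y hy => ?_⟩
    have e : inner ℝ ν x - γ (P x) - (inner ℝ ν y - γ (P y)) =
        inner ℝ ν (x - y) - (γ (P x) - γ (P y)) := by rw [inner_sub_right]; ring
    have h1 : |inner ℝ ν (x - y)| ≤ dist x y := by
      have := abs_real_inner_le_norm ν (x - y)
      rwa [hν, one_mul, ← dist_eq_norm] at this
    have h2 : |γ (P x) - γ (P y)| ≤ D * dist x y := by
      have := hD.dist_le_mul (P x) ((hPd x x₀).trans_lt hx) (P y) ((hPd y x₀).trans_lt hy)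
      rw [Real.dist_eq] at this
      exact this.trans (by gcongr; exact hPd x y)
    rw [e]
    calc _ ≤ |inner ℝ ν (x - y)| + |γ (P x) - γ (P y)| := abs_sub _ _
      _ ≤ _ := by linarith

theorem eq_zero_of_mem_frontier {n : ℕ} {Ω : Set (E n)} {x₀ : E n} {r : ℝ} {f : E n → ℝ}
    (hf : Continuous f) (h : ∀ y ∈ Metric.ball x₀ r, (y ∈ Ω ↔ 0 < f y)) {y : E n}
    (hy : y ∈ frontier Ω) (hyr : y ∈ Metric.ball x₀ r) : f y = 0 := by
  have hball := Metric.isOpen_ball.mem_nhds hyr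
  rcases lt_trichotomy (f y) 0 with h0 | h0 | h0
  · exfalso
    have : Ωᶜ ∈ nhds y := by
      filter_upwards [hball, hf.continuousAt.eventually (gt_mem_nhds h0)] with z hz hz0
      rw [mem_compl_iff, h z hz]; exact not_lt.2 hz0.le
    have hcl := mem_closure_iff_nhds.1 (frontier_subset_closure hy) _ this
    simp at hcl
  · exact h0
  · exfalso
    refine hy.2 (mem_interior_iff_mem_nhds.2 ?_)
    filter_upwards [hball, hf.continuousAt.eventually (lt_mem_nhds h0)] with z hz hz0
    exact (h z hz).2 hz0

/-- Moving from a boundary point along `-ν` makes the chart function negative, and the points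
reached lie outside `closure Ω`. This rules out slits, so the vanishing of `v` off `closure Ω`
controls it up to every boundary point. -/
theorem HasC11Boundary.frontier_subset {n : ℕ} {Ω : Set (E n)} (hΩ : HasC11Boundary Ω) :
    frontier Ω ⊆ closure (closure Ω)ᶜ := by
  intro y hy
  obtain ⟨ν, hν, r, hr, f, hf, hfν, h, _⟩ := hΩ.exists_chart hy
  have hy0 := eq_zero_of_mem_frontier hf h hy (Metric.mem_ball_self hr)
  have hlim : Filter.Tendsto (fun t : ℝ => y + (-t) • ν) (nhdsWithin 0 (Ioi 0)) (nhds y) := by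
    have : Continuous fun t : ℝ => y + (-t) • ν := by fun_prop
    simpa using (this.tendsto 0).mono_left nhdsWithin_le_nhds
  refine mem_closure_of_tendsto hlim ?_
  filter_upwards [self_mem_nhdsWithin, hlim.eventually (Metric.ball_mem_nhds y hr)] with t ht hb
  have hneg : f (y + (-t) • ν) < 0 := by rw [hfν, hy0]; linarith [mem_Ioi.1 ht]
  intro hcl
  have : Ωᶜ ∈ nhds (y + (-t) • ν) := by
    filter_upwards [Metric.isOpen_ball.mem_nhds hb,
      hf.continuousAt.eventually (gt_mem_nhds hneg)] with z hz hz0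
    rw [mem_compl_iff, h z hz]; exact not_lt.2 hz0.le
  have h2 := mem_closure_iff_nhds.1 hcl _ this
  simp at h2

/-- The `δ`-neighbourhood of the boundary has measure `O(δ)`. -/
theorem HasC11Boundary.volume_thickening_le {n : ℕ} {Ω : Set (E n)} (hΩ : HasC11Boundary Ω)
    (hb : Bornology.IsBounded Ω) :
    ∃ C : ℝ, 0 ≤ C ∧ ∃ δ₀ : ℝ, 0 < δ₀ ∧ ∀ δ ∈ Ioo 0 δ₀,
      volume (Metric.thickening δ (frontier Ω)) ≤ ENNReal.ofReal (C * δ) := by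
  have hcpt : IsCompact (frontier Ω) :=
    Metric.isCompact_of_isClosed_isBounded isClosed_frontier
      (hb.closure.subset frontier_subset_closure)
  refine hcpt.induction_on (p := fun S => ∃ C : ℝ, 0 ≤ C ∧ ∃ δ₀ : ℝ, 0 < δ₀ ∧ ∀ δ ∈ Ioo 0 δ₀,
      volume (Metric.thickening δ S) ≤ ENNReal.ofReal (C * δ)) ?_ ?_ ?_ ?_
  · exact ⟨0, le_rfl, 1, one_pos, fun δ _ => by simp⟩
  · rintro S T hST ⟨C, hC, δ₀, hδ₀, h⟩
    exact ⟨C, hC, δ₀, hδ₀, fun δ hδ =>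
      (measure_mono (Metric.thickening_subset_of_subset δ hST)).trans (h δ hδ)⟩
  · rintro S T ⟨C, hC, δ₀, hδ₀, h⟩ ⟨C', hC', δ₁, hδ₁, h'⟩
    refine ⟨C + C', by positivity, min δ₀ δ₁, lt_min hδ₀ hδ₁, fun δ hδ => ?_⟩
    have hδ0 := hδ.1
    rw [Metric.thickening_union, add_mul, ENNReal.ofReal_add (by positivity) (by positivity)]
    exact (measure_union_le _ _).trans (add_le_add
      (h δ ⟨hδ.1, hδ.2.trans_le (min_le_left _ _)⟩) (h' δ ⟨hδ.1, hδ.2.trans_le (min_le_right _ _)⟩))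
  · intro x₀ hx₀
    obtain ⟨ν, hν, r, hr, f, hf, hfν, h, Λ, hΛ, hlip⟩ := hΩ.exists_chart hx₀
    refine ⟨frontier Ω ∩ Metric.ball x₀ (r / 2),
      Filter.inter_mem self_mem_nhdsWithin
        (mem_nhdsWithin_of_mem_nhds (Metric.ball_mem_nhds _ (by positivity))),
      3 * Λ * (volume (Metric.ball x₀ (r + 1))).toReal, by positivity, r / 2, by positivity,
      fun δ hδ => ?_⟩
    have hδ0 := hδ.1
    -- The chart function vanishes on the boundary and is `Λ`-Lipschitz, so a `δ`-neighbourhood lies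
    -- in a slab of half-width `Λ δ`. Halving the radius keeps the nearby points inside the chart.
    have hsub : Metric.thickening δ (frontier Ω ∩ Metric.ball x₀ (r / 2)) ⊆
        Metric.ball x₀ r ∩ {z | |f z| ≤ Λ * δ} := by
      intro x hx
      obtain ⟨y, ⟨hy, hyr⟩, hxy⟩ := Metric.mem_thickening_iff.1 hx
      rw [Metric.mem_ball] at hyr
      have hyb : y ∈ Metric.ball x₀ r := by rw [Metric.mem_ball]; linarith
      have hxb : x ∈ Metric.ball x₀ r := by
        rw [Metric.mem_ball]; linarith [dist_triangle x y x₀, hδ.2]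
      refine ⟨hxb, ?_⟩
      have h1 := hlip x hxb y hyb
      rw [eq_zero_of_mem_frontier hf h hy hyb, sub_zero] at h1
      exact h1.trans (by gcongr)
    refine (measure_mono hsub).trans ((volume_slab_le hν hf hfν x₀ r (by positivity)).trans ?_)
    rw [← ENNReal.ofReal_toReal (measure_ball_lt_top (μ := volume) (x := x₀) (r := r + 1)).ne,
      ← ENNReal.ofReal_mul (by positivity)]
    apply ENNReal.ofReal_le_ofReal
    rw [ENNReal.toReal_ofReal (by positivity)]
    apply le_of_eq; ring

end Boundary

/-! ### Weak derivatives and the linear growth bound. -/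

section WeakDerivative

variable {n : ℕ}

/-- The standard basis vectors of `ℝⁿ`. -/
abbrev basisVec (j : Fin n) : E n := EuclideanSpace.single j 1

theorem norm_basisVec (j : Fin n) : ‖basisVec j‖ = 1 := by simp

theorem abs_apply_le_norm (v : E n) (j : Fin n) : |v j| ≤ ‖v‖ := PiLp.norm_apply_le v j

theorem norm_le_of_forall_abs_le {L : E n →L[ℝ] ℝ} {B : ℝ} (hB : 0 ≤ B)
    (h : ∀ j, |L (basisVec j)| ≤ B) : ‖L‖ ≤ n * B := by
  refine L.opNorm_le_bound (by positivity) fun v => ?_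
  have hv : v = ∑ j, v j • basisVec j := by
    have := (EuclideanSpace.basisFun (Fin n) ℝ).sum_repr v
    simpa using this.symm
  have : L v = ∑ j, v j * L (basisVec j) := by
    conv_lhs => rw [hv]
    simp [map_sum]
  rw [this, Real.norm_eq_abs]
  calc |∑ j, v j * L (basisVec j)| ≤ ∑ j, |v j * L (basisVec j)| :=
        Finset.abs_sum_le_sum_abs _ _
    _ ≤ ∑ _j : Fin n, ‖v‖ * B := by
        refine Finset.sum_le_sum fun j _ => ?_
        rw [abs_mul]
        exact mul_le_mul (abs_apply_le_norm v j) (h j) (abs_nonneg _) (norm_nonneg _)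
    _ = n * B * ‖v‖ := by simp; ring

theorem locallyIntegrable_of_univ {f : E n → ℝ} (h : LocallyIntegrableOn f univ) :
    LocallyIntegrable f := locallyIntegrableOn_univ.1 h

theorem integral_mul_fderiv_of_contDiff {f φ : E n → ℝ} (hf : ContDiff ℝ ∞ f)
    (hφ : ContDiff ℝ ∞ φ) (hc : HasCompactSupport φ) (v : E n) :
    ∫ x, f x * fderiv ℝ φ x v = -∫ x, fderiv ℝ f x v * φ x := by
  have hfc := hf.continuous
  have hφc := hφ.continuous
  have h1 := (contDiff_fderiv_apply hf v).continuous
  have h2 := (contDiff_fderiv_apply hφ v).continuous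
  refine integral_mul_fderiv_eq_neg_fderiv_mul_of_integrable ?_ ?_ ?_
    (fun x _ => hf.differentiable (by simp) x) (fun x _ => hφ.differentiable (by simp) x)
  · exact (h1.mul hφc).integrable_of_hasCompactSupport hc.mul_left
  · exact (hfc.mul h2).integrable_of_hasCompactSupport
      (hasCompactSupport_fderiv_apply hc v).mul_left
  · exact (hfc.mul hφc).integrable_of_hasCompactSupport hc.mul_left

theorem integral_fderiv_eq_zero {φ : E n → ℝ} (hφ : ContDiff ℝ ∞ φ)
    (hc : HasCompactSupport φ) (v : E n) : ∫ x, fderiv ℝ φ x v = 0 := by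
  simpa using integral_mul_fderiv_of_contDiff (f := fun _ => 1) contDiff_const hφ hc v

theorem hasWeakPartialOn_of_contDiff {f : E n → ℝ} (hf : ContDiff ℝ ∞ f) (U : Set (E n))
    (j : Fin n) : HasWeakPartialOn U j f (fun x => fderiv ℝ f x (basisVec j)) :=
  ⟨hf.continuous.locallyIntegrable.locallyIntegrableOn U,
    (contDiff_fderiv_apply hf _).continuous.locallyIntegrable.locallyIntegrableOn U,
    fun _ hφ hc _ => integral_mul_fderiv_of_contDiff hf hφ hc _⟩

theorem HasWeakPartialOn.add_contDiff {f g a : E n → ℝ} {j : Fin n}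
    (h : HasWeakPartialOn univ j f g) (ha : ContDiff ℝ ∞ a) :
    HasWeakPartialOn univ j (fun x => f x + a x)
      (fun x => g x + fderiv ℝ a x (basisVec j)) := by
  obtain ⟨h1, h2, h3⟩ := h
  obtain ⟨a1, a2, a3⟩ := hasWeakPartialOn_of_contDiff ha univ j
  refine ⟨h1.add a1, h2.add a2, fun φ hφ hc hU => ?_⟩
  have hφc := hφ.continuous
  have hφd := (contDiff_fderiv_apply hφ (basisVec j)).continuous
  have hcd := hasCompactSupport_fderiv_apply hc (basisVec j)
  have key : ∀ {p ψ : E n → ℝ}, LocallyIntegrableOn p univ → Continuous ψ →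
      HasCompactSupport ψ → Integrable fun x => p x * ψ x := fun {p ψ} hp hψ hψc =>
    (locallyIntegrable_of_univ hp).integrable_smul_right_of_hasCompactSupport hψ hψc
  simp only [add_mul]
  rw [integral_add (key h1 hφd hcd) (key a1 hφd hcd), integral_add (key h2 hφc hc)
    (key a2 hφc hc), h3 φ hφ hc hU, a3 φ hφ hc hU]
  ring

theorem HasWeakPartialOn.ae_eq {f g g' : E n → ℝ} {j : Fin n}
    (h : HasWeakPartialOn univ j f g) (h' : HasWeakPartialOn univ j f g') :
    g =ᵐ[volume] g' := by
  refine ae_eq_of_integral_contDiff_smul_eq (locallyIntegrable_of_univ h.2.1)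
    (locallyIntegrable_of_univ h'.2.1) fun φ hφ hc => ?_
  have e1 := h.2.2 φ hφ hc (subset_univ _)
  have e2 := h'.2.2 φ hφ hc (subset_univ _)
  simp only [smul_eq_mul, mul_comm (φ _)]
  linarith

/-- The test function in the definition of the weak derivative may be complex valued. -/
theorem HasWeakPartialOn.integral_complex {f g : E n → ℝ} {j : Fin n}
    (h : HasWeakPartialOn univ j f g) {φ : E n → ℂ} (hφ : ContDiff ℝ ∞ φ)
    (hc : HasCompactSupport φ) :
    ∫ x, fderiv ℝ φ x (basisVec j) * (f x : ℂ) = -∫ x, φ x * (g x : ℂ) := by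
  have hdc : HasCompactSupport fun x => fderiv ℝ φ x (basisVec j) :=
    (hc.fderiv ℝ).comp_left (g := fun L : E n →L[ℝ] ℂ => L (basisVec j)) rfl
  have hd : Continuous fun x => fderiv ℝ φ x (basisVec j) :=
    ((hφ.fderiv_right (m := ∞) (by simp)).clm_apply contDiff_const).continuous
  have hi : ∀ {p : E n → ℝ} {ψ : E n → ℂ}, LocallyIntegrableOn p univ → Continuous ψ →
      HasCompactSupport ψ → Integrable fun x => ψ x * (p x : ℂ) := fun {p ψ} hp hψ hψc => by
    have := (locallyIntegrable_of_univ hp).integrable_smul_right_of_hasCompactSupport hψ hψc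
    simpa [mul_comm] using this
  -- Real and imaginary parts are treated at once, through a real functional `P` that commutes with
  -- multiplication by reals.
  have real : ∀ (P : ℂ →L[ℝ] ℝ), (∀ (z : ℂ) (r : ℝ), P (z * r) = r * P z) →
      P (∫ x, fderiv ℝ φ x (basisVec j) * (f x : ℂ)) = P (-∫ x, φ x * (g x : ℂ)) := by
    intro P hP
    rw [map_neg, ← P.integral_comp_comm (hi h.1 hd hdc),
      ← P.integral_comp_comm (hi h.2.1 hφ.continuous hc)]
    simp only [hP]
    have hPφ : ContDiff ℝ ∞ (fun x => P (φ x)) := P.contDiff.comp hφ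
    have hPc : HasCompactSupport (fun x => P (φ x)) := hc.comp_left (g := P) (map_zero P)
    rw [← h.2.2 _ hPφ hPc (subset_univ _)]
    congr 1
    ext x
    have : HasFDerivAt (fun x => P (φ x)) (P.comp (fderiv ℝ φ x)) x :=
      P.hasFDerivAt.comp x (hφ.differentiable (by simp) x).hasFDerivAt
    rw [this.fderiv]; rfl
  refine Complex.ext (real Complex.reCLM fun z r => ?_) (real Complex.imCLM fun z r => ?_)
  · simp [mul_comm]
  · simp [mul_comm]

/-- Mollification turns the weak derivative into the classical one. -/
theorem HasWeakPartialOn.fderiv_conv {f g φ : E n → ℝ} {j : Fin n}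
    (h : HasWeakPartialOn univ j f g) (hφ : ContDiff ℝ ∞ φ) (hc : HasCompactSupport φ)
    (x : E n) : fderiv ℝ (conv f φ) x (basisVec j) = conv g φ x := by
  rw [Wells.fderiv_conv (locallyIntegrable_of_univ h.1) hφ hc, conv_apply, conv_apply]
  have hs : ContDiff ℝ ∞ fun y => φ (x - y) := hφ.comp (contDiff_const.sub contDiff_id)
  have hsc : HasCompactSupport fun y => φ (x - y) :=
    hc.comp_homeomorph (Homeomorph.subLeft x)
  have h1 := h.2.2 _ hs hsc (subset_univ _)
  have hd : ∀ y, fderiv ℝ (fun y => φ (x - y)) y (basisVec j) =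
      -fderiv ℝ φ (x - y) (basisVec j) := fun y => by
    have e1 : HasFDerivAt φ (fderiv ℝ φ (x - y)) (x - y) :=
      (hφ.differentiable (by simp) _).hasFDerivAt
    have e2 : HasFDerivAt (fun y : E n => x - y) (-ContinuousLinearMap.id ℝ (E n)) y :=
      (hasFDerivAt_id y).const_sub x
    have e3 : HasFDerivAt (fun y => φ (x - y)) _ y := e1.comp y e2
    rw [e3.fderiv]; simp
  simp only [hd, mul_neg, integral_neg, neg_inj] at h1
  exact h1

/-- A function with bounded weak gradient that vanishes outside a closed set grows at most
linearly away from points outside that set. -/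
theorem ae_abs_le_dist {f : E n → ℝ} {g : Fin n → E n → ℝ}
    (h : ∀ j, HasWeakPartialOn univ j f (g j)) {B : ℝ} (hB : 0 ≤ B)
    (hg : ∀ j, ∀ᵐ x, |g j x| ≤ B) {S : Set (E n)} (hS : IsClosed S)
    (hf : ∀ᵐ x ∂volume.restrict Sᶜ, f x = 0) (hloc : LocallyIntegrable f) :
    ∀ᵐ x, ∀ z ∈ Sᶜ, |f x| ≤ n * B * dist x z := by
  -- The radii shrink to zero with fixed ratio two, as needed for a.e. convergence of `f * b k` to
  -- `f`. Each mollification is Lipschitz with the uniform constant `n B` and eventually vanishes at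
  -- `z`; the exceptional null set of `x` does not depend on `z`.
  let b : ℕ → ContDiffBump (0 : E n) := fun k =>
    ⟨1 / (k + 1) / 2, 1 / (k + 1), by positivity, half_lt_self (by positivity)⟩
  have hb0 : Filter.Tendsto (fun k => (b k).rOut) Filter.atTop (nhds 0) :=
    tendsto_one_div_add_atTop_nhds_zero_nat
  have hlim := ContDiffBump.ae_convolution_tendsto_right_of_locallyIntegrable (μ := volume)
    (φ := b) (K := 2) hb0 (.of_forall fun k => by simp only [b]; linarith) hloc
  rw [ae_restrict_iff' hS.measurableSet.compl] at hf
  have hc : ∀ k x, convolution ((b k).normed volume) f (ContinuousLinearMap.lsmul ℝ ℝ) volume x =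
      conv f ((b k).normed volume) x := fun k x => by
    rw [convolution_def, conv_apply, ← integral_sub_left_eq_self _ volume x]
    simp [mul_comm]
  simp only [hc] at hlim
  filter_upwards [hlim] with x hx z hz
  have hlip : ∀ k, |conv f ((b k).normed volume) x - conv f ((b k).normed volume) z| ≤
      n * B * dist x z := by
    intro k
    have hρ : ContDiff ℝ ∞ ((b k).normed volume) := (b k).contDiff_normed
    have hρc : HasCompactSupport ((b k).normed volume) := (b k).hasCompactSupport_normed
    have hdiff := (contDiff_conv hloc hρ hρc).differentiable (by simp)
    have := convex_univ.norm_image_sub_le_of_norm_fderiv_le (𝕜 := ℝ) (C := n * B)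
      (fun y _ => hdiff y) (fun y _ => norm_le_of_forall_abs_le hB fun j => ?_)
      (mem_univ z) (mem_univ x)
    · rwa [dist_eq_norm]
    · rw [(h j).fderiv_conv hρ hρc]
      have h1 := abs_conv_le (f := g j) (ε := (b k).rOut) (B := B) hρ.continuous hρc (fun y hy => by
        have : y ∉ Function.support ((b k).normed volume) := by
          rw [(b k).support_normed_eq, Metric.mem_ball, dist_zero_right, not_lt]; exact hy
        exact Function.notMem_support.1 this) (x := y)
        (by filter_upwards [hg j] with y hy _ using hy)
      refine h1.trans (le_of_eq ?_)
      have h2 : ∫ y, |(b k).normed volume y| = ∫ y, (b k).normed volume y :=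
        integral_congr_ae (.of_forall fun y => abs_of_nonneg ((b k).nonneg_normed y))
      rw [h2, (b k).integral_normed, mul_one]
  have hz0 : ∀ᶠ k in Filter.atTop, conv f ((b k).normed volume) z = 0 := by
    obtain ⟨r, hr, hball⟩ := Metric.isOpen_iff.1 hS.isOpen_compl z hz
    filter_upwards [hb0.eventually (gt_mem_nhds hr)] with k hk
    have := conv_eq_const (f := f) (c := 0) (ε := r) (φ := (b k).normed volume) (fun y hy => by
        have : y ∉ Function.support ((b k).normed volume) := by
          rw [(b k).support_normed_eq, Metric.mem_ball, dist_zero_right, not_lt]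
          exact hk.le.trans hy
        exact Function.notMem_support.1 this) (x := z)
        (by filter_upwards [hf] with y hy hyb using hy (hball hyb))
    simpa using this
  refine le_of_tendsto hx.abs ?_
  filter_upwards [hz0] with k hk
  simpa [hk] using hlip k

end WeakDerivative

/-! ### Mollification estimates in fractional Sobolev spaces. -/

section SobolevMollification

open FourierTransform LineDeriv

variable {n : ℕ}

/-- The squared `H^s` norm, computed from the Fourier integral. -/
def sobolevSq (s : ℝ) (w : E n → ℝ) : ℝ≥0∞ :=
  ∫⁻ ξ, ENNReal.ofReal ((1 + ‖ξ‖ ^ 2) ^ s) * ‖𝓕 (fun x => (w x : ℂ)) ξ‖ₑ ^ 2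

theorem integrable_complex {h : E n → ℝ} (hi : Integrable h) :
    Integrable fun x => (h x : ℂ) := hi.ofReal

theorem memLp_two_of_bounded {h : E n → ℝ} {B : ℝ} (hi : Integrable h)
    (hB : ∀ᵐ x, |h x| ≤ B) : MemLp (fun x => (h x : ℂ)) 2 := by
  rw [memLp_two_iff_integrable_sq_norm (integrable_complex hi).aestronglyMeasurable]
  refine (hi.norm.const_mul B).mono' ((integrable_complex hi).aestronglyMeasurable.norm.pow 2) ?_
  filter_upwards [hB] with x hx
  rw [Complex.norm_real, Real.norm_of_nonneg (by positivity), Real.norm_eq_abs, sq]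
  gcongr

theorem integrable_conv {w ψ : E n → ℝ} (hw : Integrable w) (hψ : Integrable ψ) :
    Integrable (conv w ψ) :=
  hw.integrable_convolution (ContinuousLinearMap.mul ℝ ℝ) hψ

theorem fourier_ofReal_conv {w ψ : E n → ℝ} (hw : Integrable w) (hψ : Integrable ψ) (ξ : E n) :
    𝓕 (fun x => (conv w ψ x : ℂ)) ξ =
      𝓕 (fun x => (w x : ℂ)) ξ * 𝓕 (fun x => (ψ x : ℂ)) ξ := by
  rw [← Real.fourier_mul_convolution_eq (integrable_complex hw) (integrable_complex hψ)]
  refine congrArg (fun F : E n → ℂ => 𝓕 F ξ) (funext fun x => ?_)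
  rw [conv_apply, convolution_def, ← integral_complex_ofReal]
  simp

/-- The error has Fourier symbol `𝓕 ρ - 1`, the oscillation of `𝓕 ρ` from its value at zero; `∫ |ρ|
= 1` gives the constant `2π`. -/
theorem lintegral_conv_sub_sq_le {C ε s B : ℝ} (hs : 0 ≤ s) (hs1 : s ≤ 1) (hε : 0 < ε)
    {ρ w : E n → ℝ} (hρ : IsMollifier C ε ρ) (hw : Integrable w) (hB : ∀ᵐ x, |w x| ≤ B) :
    ∫⁻ x, ENNReal.ofReal ((conv w ρ x - w x) ^ 2) ≤
      ENNReal.ofReal ((2 * Real.pi) ^ 2 * ε ^ (2 * s)) * sobolevSq s w := by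
  have hρi : Integrable ρ :=
    hρ.contDiff.continuous.integrable_of_hasCompactSupport hρ.hasCompactSupport
  have hci := integrable_conv hw hρi
  have hint : Integrable fun x => conv w ρ x - w x := hci.sub hw
  have habs : ∫ x, ‖(ρ x : ℂ)‖ = 1 := by
    rw [← hρ.integral_eq_one]
    refine integral_congr_ae (.of_forall fun x => ?_)
    simp [abs_of_nonneg (hρ.nonneg x)]
  have hbd : ∀ᵐ x, |conv w ρ x - w x| ≤ B * (∫ y, |ρ y|) + B := by
    filter_upwards [hB] with x hx
    refine (abs_sub _ _).trans (add_le_add ?_ hx)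
    exact abs_conv_le hρ.contDiff.continuous hρ.hasCompactSupport hρ.eq_zero
      (by filter_upwards [hB] with y hy _ using hy)
  have h := lintegral_enorm_sq_le_of_fourier (w := fun x => (w x : ℂ)) hs hs1 hε
    (A := 2 * Real.pi) (integrable_complex hint) (memLp_two_of_bounded hint hbd) fun ξ => ?_
  · refine le_trans (le_of_eq (lintegral_congr fun x => ?_)) h
    rw [← ofReal_norm, Complex.norm_real, ← ENNReal.ofReal_pow (norm_nonneg _),
      Real.norm_eq_abs, sq_abs]
  · have e : 𝓕 (fun x => ((conv w ρ x - w x : ℝ) : ℂ)) ξ =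
        𝓕 (fun x => (conv w ρ x : ℂ)) ξ - 𝓕 (fun x => (w x : ℂ)) ξ := by
      simp only [Complex.ofReal_sub, Real.fourier_eq, smul_sub]
      refine integral_sub ?_ ?_
      · exact (Real.fourierIntegral_convergent_iff ξ).2 (integrable_complex hci)
      · exact (Real.fourierIntegral_convergent_iff ξ).2 (integrable_complex hw)
    have h1 := norm_fourier_sub_integral_le (ε := ε) (integrable_complex hρi)
      (fun x hx => by simp [hρ.eq_zero x hx]) ξ
    rw [habs, integral_complex_ofReal, hρ.integral_eq_one, mul_one] at h1
    have e2 : 𝓕 (fun x => (w x : ℂ)) ξ * 𝓕 (fun x => (ρ x : ℂ)) ξ - 𝓕 (fun x => (w x : ℂ)) ξ =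
        (𝓕 (fun x => (ρ x : ℂ)) ξ - ((1 : ℝ) : ℂ)) * 𝓕 (fun x => (w x : ℂ)) ξ := by
      push_cast; ring
    rw [e, fourier_ofReal_conv hw hρi, e2, norm_mul]
    gcongr

/-- Zero mean means that `𝓕 ψ` vanishes at the origin, so the same oscillation bound controls the
symbol itself. The intended `ψ` is a derivative of a mollifier, whose `L¹` norm supplies the factor
`1/ε`. -/
theorem lintegral_conv_sq_le {ε s B : ℝ} (hs : 0 ≤ s) (hs1 : s ≤ 1) (hε : 0 < ε)
    {ψ w : E n → ℝ} (hψ : Continuous ψ) (hc : HasCompactSupport ψ)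
    (hsupp : ∀ x, ε ≤ ‖x‖ → ψ x = 0) (h0 : ∫ x, ψ x = 0)
    (hw : Integrable w) (hB : ∀ᵐ x, |w x| ≤ B) :
    ∫⁻ x, ENNReal.ofReal (conv w ψ x ^ 2) ≤
      ENNReal.ofReal ((2 * Real.pi * ∫ x, |ψ x|) ^ 2 * ε ^ (2 * s)) * sobolevSq s w := by
  have hψi : Integrable ψ := hψ.integrable_of_hasCompactSupport hc
  have hint := integrable_conv hw hψi
  have hbd : ∀ᵐ x, |conv w ψ x| ≤ B * (∫ y, |ψ y|) := .of_forall fun x =>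
    abs_conv_le hψ hc hsupp (by filter_upwards [hB] with y hy _ using hy)
  have h := lintegral_enorm_sq_le_of_fourier (w := fun x => (w x : ℂ)) hs hs1 hε
    (A := 2 * Real.pi * ∫ x, |ψ x|) (integrable_complex hint)
    (memLp_two_of_bounded hint hbd) fun ξ => ?_
  · refine le_trans (le_of_eq (lintegral_congr fun x => ?_)) h
    rw [← ofReal_norm, Complex.norm_real, ← ENNReal.ofReal_pow (norm_nonneg _),
      Real.norm_eq_abs, sq_abs]
  · have h1 := norm_fourier_sub_integral_le (ε := ε) (integrable_complex hψi)
      (fun x hx => by simp [hsupp x hx]) ξ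
    rw [integral_complex_ofReal, h0] at h1
    simp only [Complex.norm_real, Real.norm_eq_abs, Complex.ofReal_zero, sub_zero] at h1
    rw [fourier_ofReal_conv hw hψi, mul_comm, norm_mul]
    gcongr

/-- Differentiating `T` lowers its order by one, and integration by parts against compactly
supported tests shows that the derivative is represented by `w`. -/
theorem sobolevSq_lt_top_of_hasWeakPartialOn {s B : ℝ} (hs : 0 ≤ s) {f w : E n → ℝ} {j : Fin n}
    (h : HasWeakPartialOn univ j f w) (hw : Integrable w) (hB : ∀ᵐ x, |w x| ≤ B)
    {T : 𝓢'(E n, ℂ)} (hT : TemperedDistribution.MemSobolev (1 + s) 2 T)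
    (hf : ∀ φ : 𝓢(E n, ℂ), HasCompactSupport φ → T φ = ∫ x, φ x * ((f x : ℝ) : ℂ)) :
    sobolevSq s w < ⊤ := by
  have hd : TemperedDistribution.MemSobolev s 2 (∂_{basisVec j} T) := by
    have := hT.lineDerivOp (m := basisVec j)
    rwa [add_sub_cancel_left] at this
  refine lintegral_weight_fourier_lt_top hs (integrable_complex hw) (memLp_two_of_bounded hw hB) hd
    fun φ hφ => ?_
  have hφd : HasCompactSupport (∂_{basisVec j} φ : 𝓢(E n, ℂ)) :=
    (hφ.fderiv ℝ).comp_left (g := fun L : E n →L[ℝ] ℂ => L (basisVec j)) rfl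
  rw [TemperedDistribution.lineDerivOp_apply_apply, map_neg, hf _ hφd]
  have := h.integral_complex (φ.smooth ⊤) hφ
  simp only [SchwartzMap.lineDerivOp_apply_eq_fderiv]
  rw [this, neg_neg]

end SobolevMollification

/-! ### The boundary cutoff and its derivatives. -/

section Cutoff

variable {n : ℕ}

/-- A mollified indicator of the points at distance at least `2 ε` from the complement of `Ω`. -/
def cutoff (Ω : Set (E n)) (ε : ℝ) (ρ : E n → ℝ) : E n → ℝ :=
  conv ((Metric.thickening (2 * ε) Ωᶜ)ᶜ.indicator 1) ρ

theorem locallyIntegrable_indicator (Ω : Set (E n)) (ε : ℝ) :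
    LocallyIntegrable ((Metric.thickening (2 * ε) Ωᶜ)ᶜ.indicator (1 : E n → ℝ)) :=
  (locallyIntegrable_const (1 : ℝ)).indicator Metric.isOpen_thickening.measurableSet.compl

theorem abs_indicator_one_le (S : Set (E n)) (x : E n) :
    |S.indicator (1 : E n → ℝ) x| ≤ 1 := by
  by_cases h : x ∈ S <;> simp [h]

variable {Ω : Set (E n)} {C ε : ℝ} {ρ : E n → ℝ}

theorem IsMollifier.integral_abs (hρ : IsMollifier C ε ρ) : ∫ x, |ρ x| = 1 := by
  rw [← hρ.integral_eq_one]
  exact integral_congr_ae (.of_forall fun x => abs_of_nonneg (hρ.nonneg x))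

theorem IsMollifier.fderiv_eq_zero (hρ : IsMollifier C ε ρ) (e : E n) (x : E n)
    (hx : ε ≤ ‖x‖) : fderiv ℝ ρ x e = 0 :=
  fderiv_eq_zero_of_forall_le_norm hρ.contDiff hρ.eq_zero x hx e

theorem contDiff_cutoff (hρ : IsMollifier C ε ρ) : ContDiff ℝ ∞ (cutoff Ω ε ρ) :=
  contDiff_conv (locallyIntegrable_indicator Ω ε) hρ.contDiff hρ.hasCompactSupport

theorem fderiv_cutoff (hρ : IsMollifier C ε ρ) (x e : E n) :
    fderiv ℝ (cutoff Ω ε ρ) x e =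
      conv ((Metric.thickening (2 * ε) Ωᶜ)ᶜ.indicator 1) (fun y => fderiv ℝ ρ y e) x :=
  fderiv_conv (locallyIntegrable_indicator Ω ε) hρ.contDiff hρ.hasCompactSupport x e

theorem fderiv_fderiv_cutoff (hρ : IsMollifier C ε ρ) (x e e' : E n) :
    fderiv ℝ (fun y => fderiv ℝ (cutoff Ω ε ρ) y e) x e' =
      conv ((Metric.thickening (2 * ε) Ωᶜ)ᶜ.indicator 1)
        (fun z => fderiv ℝ (fun y => fderiv ℝ ρ y e) z e') x := by
  simp_rw [fderiv_cutoff hρ]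
  exact fderiv_conv (locallyIntegrable_indicator Ω ε) (contDiff_fderiv_apply hρ.contDiff e)
    (hasCompactSupport_fderiv_apply hρ.hasCompactSupport e) x e'

theorem abs_cutoff_le (hρ : IsMollifier C ε ρ) (x : E n) : |cutoff Ω ε ρ x| ≤ 1 := by
  have := abs_conv_le (B := 1) (x := x) hρ.contDiff.continuous hρ.hasCompactSupport hρ.eq_zero
    (.of_forall fun y _ => abs_indicator_one_le (Metric.thickening (2 * ε) Ωᶜ)ᶜ y)
  rwa [hρ.integral_abs, one_mul] at this

theorem abs_fderiv_cutoff_le (hρ : IsMollifier C ε ρ) (x : E n) {e : E n} (he : ‖e‖ ≤ 1) :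
    |fderiv ℝ (cutoff Ω ε ρ) x e| ≤ C / ε := by
  rw [fderiv_cutoff hρ]
  have := abs_conv_le (B := 1) (x := x) (contDiff_fderiv_apply hρ.contDiff e).continuous
    (hasCompactSupport_fderiv_apply hρ.hasCompactSupport e) (hρ.fderiv_eq_zero e)
    (.of_forall fun y _ => abs_indicator_one_le (Metric.thickening (2 * ε) Ωᶜ)ᶜ y)
  linarith [hρ.integral_fderiv e he]

theorem IsMollifier.fderiv_fderiv_eq_zero (hρ : IsMollifier C ε ρ) (e e' : E n) (x : E n)
    (hx : ε ≤ ‖x‖) : fderiv ℝ (fun y => fderiv ℝ ρ y e) x e' = 0 :=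
  fderiv_eq_zero_of_forall_le_norm (contDiff_fderiv_apply hρ.contDiff e)
    (hρ.fderiv_eq_zero e) x hx e'

theorem abs_fderiv_fderiv_cutoff_le (hρ : IsMollifier C ε ρ) (x : E n) {e e' : E n}
    (he : ‖e‖ ≤ 1) (he' : ‖e'‖ ≤ 1) :
    |fderiv ℝ (fun y => fderiv ℝ (cutoff Ω ε ρ) y e) x e'| ≤ C / ε ^ 2 := by
  rw [fderiv_fderiv_cutoff hρ]
  have hd := contDiff_fderiv_apply hρ.contDiff e
  have hc := hasCompactSupport_fderiv_apply hρ.hasCompactSupport e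
  have := abs_conv_le (B := 1) (x := x) (contDiff_fderiv_apply hd e').continuous
    (hasCompactSupport_fderiv_apply hc e') (hρ.fderiv_fderiv_eq_zero e e')
    (.of_forall fun y _ => abs_indicator_one_le (Metric.thickening (2 * ε) Ωᶜ)ᶜ y)
  linarith [hρ.integral_fderiv_fderiv e e' he he']

theorem cutoff_eq_zero (hρ : IsMollifier C ε ρ) {x : E n} (hx : x ∈ Metric.thickening ε Ωᶜ) :
    cutoff Ω ε ρ x = 0 := by
  obtain ⟨z, hz, hxz⟩ := Metric.mem_thickening_iff.1 hx
  have := conv_eq_const (f := (Metric.thickening (2 * ε) Ωᶜ)ᶜ.indicator (1 : E n → ℝ)) (c := 0)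
    (x := x) hρ.eq_zero (.of_forall fun y hy => by
      have hyz : y ∈ Metric.thickening (2 * ε) Ωᶜ := Metric.mem_thickening_iff.2
        ⟨z, hz, by linarith [dist_triangle y x z, Metric.mem_ball.1 hy]⟩
      exact indicator_of_notMem (not_not.2 hyz) _)
  rw [cutoff, this, zero_mul]

/-- At distance at least `3ε` from the complement, the whole `ε`-ball stays at distance at least
`2ε`, where the indicator is one. Taking `ψ` to be `ρ` or one of its derivatives gives the values of
the cutoff and of its derivatives in the interior. -/
theorem conv_indicator_eq {ψ : E n → ℝ} (hψ : ∀ x, ε ≤ ‖x‖ → ψ x = 0) {x : E n}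
    (hx : x ∉ Metric.thickening (3 * ε) Ωᶜ) :
    conv ((Metric.thickening (2 * ε) Ωᶜ)ᶜ.indicator 1) ψ x = ∫ y, ψ y := by
  rw [conv_eq_const (c := 1) hψ (.of_forall fun y hy => ?_), one_mul]
  have hyz : y ∉ Metric.thickening (2 * ε) Ωᶜ := fun h => by
    obtain ⟨z, hz, hyz⟩ := Metric.mem_thickening_iff.1 h
    refine hx (Metric.mem_thickening_iff.2 ⟨z, hz, ?_⟩)
    linarith [dist_triangle x y z, Metric.mem_ball'.1 hy]
  exact indicator_of_mem hyz _

theorem cutoff_eq_one (hρ : IsMollifier C ε ρ) {x : E n}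
    (hx : x ∉ Metric.thickening (3 * ε) Ωᶜ) : cutoff Ω ε ρ x = 1 := by
  rw [cutoff, conv_indicator_eq hρ.eq_zero hx, hρ.integral_eq_one]

theorem fderiv_cutoff_eq_zero (hρ : IsMollifier C ε ρ) {x : E n}
    (hx : x ∉ Metric.thickening (3 * ε) Ωᶜ) (e : E n) :
    fderiv ℝ (cutoff Ω ε ρ) x e = 0 := by
  rw [fderiv_cutoff hρ, conv_indicator_eq (hρ.fderiv_eq_zero e) hx,
    integral_fderiv_eq_zero hρ.contDiff hρ.hasCompactSupport]

theorem fderiv_fderiv_cutoff_eq_zero (hρ : IsMollifier C ε ρ) {x : E n}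
    (hx : x ∉ Metric.thickening (3 * ε) Ωᶜ) (e e' : E n) :
    fderiv ℝ (fun y => fderiv ℝ (cutoff Ω ε ρ) y e) x e' = 0 := by
  rw [fderiv_fderiv_cutoff hρ, conv_indicator_eq (hρ.fderiv_fderiv_eq_zero e e') hx,
    integral_fderiv_eq_zero (contDiff_fderiv_apply hρ.contDiff e)
      (hasCompactSupport_fderiv_apply hρ.hasCompactSupport e)]

end Cutoff

/-! ### Pointwise estimates for the cut-off mollified field. -/

section CutoffField

variable {n : ℕ}

/-- Functions with bounded integrable weak gradient `w` that vanish outside `closure Ω`, in the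
quantitative form of a linear bound by the distance to points outside `closure Ω`. -/
structure IsLipschitzField (Ω : Set (E n)) (B : ℝ) (f : E n → ℝ) (w : Fin n → E n → ℝ) :
    Prop where
  nonneg : 0 ≤ B
  weakPartial : ∀ j, HasWeakPartialOn univ j f (w j)
  bound : ∀ j, ∀ᵐ x, |w j x| ≤ B
  integrable : ∀ j, Integrable (w j)
  locallyIntegrable : LocallyIntegrable f
  abs_le_dist : ∀ᵐ x, ∀ z ∈ (closure Ω)ᶜ, |f x| ≤ n * B * dist x z

/-- The mollification of `f`, cut off near the boundary of `Ω`. -/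
def cutoffField (Ω : Set (E n)) (ε : ℝ) (ρ f : E n → ℝ) (x : E n) : ℝ :=
  cutoff Ω ε ρ x * conv f ρ x

variable {Ω : Set (E n)} {B C ε : ℝ} {ρ f : E n → ℝ} {w : Fin n → E n → ℝ}

/-- The part of `Ω` within `δ` of its complement. -/
def boundaryLayer (Ω : Set (E n)) (δ : ℝ) : Set (E n) := Metric.thickening δ Ωᶜ ∩ Ω

theorem boundaryLayer_subset (δ : ℝ) :
    boundaryLayer Ω δ ⊆ Metric.thickening δ (frontier Ω) := by
  rintro x ⟨hx, hxΩ⟩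
  obtain ⟨z, hz, hxz⟩ := Metric.mem_thickening_iff.1 hx
  obtain ⟨y, hy, hxy⟩ := exists_mem_frontier_infDist_compl_eq_dist hxΩ
    (fun h => hz (h ▸ mem_univ z))
  exact Metric.mem_thickening_iff.2 ⟨y, hy, hxy ▸ (Metric.infDist_le_dist_of_mem hz).trans_lt hxz⟩

theorem contDiff_cutoffField (hf : IsLipschitzField Ω B f w) (hρ : IsMollifier C ε ρ) :
    ContDiff ℝ ∞ (cutoffField Ω ε ρ f) :=
  (contDiff_cutoff hρ).mul
    (contDiff_conv hf.locallyIntegrable hρ.contDiff hρ.hasCompactSupport)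

theorem fderiv_mul_apply' {p q : E n → ℝ} (hp : ContDiff ℝ ∞ p) (hq : ContDiff ℝ ∞ q)
    (x e : E n) : fderiv ℝ (fun y => p y * q y) x e =
      fderiv ℝ p x e * q x + p x * fderiv ℝ q x e := by
  rw [fderiv_fun_mul (hp.differentiable (by simp) x) (hq.differentiable (by simp) x)]
  simp only [add_apply, smul_apply, smul_eq_mul]
  ring

theorem fderiv_cutoffField (hf : IsLipschitzField Ω B f w) (hρ : IsMollifier C ε ρ) (x : E n)
    (j : Fin n) : fderiv ℝ (cutoffField Ω ε ρ f) x (basisVec j) =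
      fderiv ℝ (cutoff Ω ε ρ) x (basisVec j) * conv f ρ x +
        cutoff Ω ε ρ x * conv (w j) ρ x := by
  rw [← (hf.weakPartial j).fderiv_conv hρ.contDiff hρ.hasCompactSupport]
  exact fderiv_mul_apply' (contDiff_cutoff hρ)
    (contDiff_conv hf.locallyIntegrable hρ.contDiff hρ.hasCompactSupport) x _

/-- Only one derivative can be passed to `f`, since `w j` need not be weakly differentiable; when
both fall on the mollified field, the second falls on `ρ`. -/
theorem fderiv_fderiv_cutoffField (hf : IsLipschitzField Ω B f w) (hρ : IsMollifier C ε ρ)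
    (x : E n) (j k : Fin n) :
    fderiv ℝ (fun y => fderiv ℝ (cutoffField Ω ε ρ f) y (basisVec j)) x (basisVec k) =
      (fderiv ℝ (fun y => fderiv ℝ (cutoff Ω ε ρ) y (basisVec j)) x (basisVec k) * conv f ρ x +
        fderiv ℝ (cutoff Ω ε ρ) x (basisVec j) * conv (w k) ρ x) +
      (fderiv ℝ (cutoff Ω ε ρ) x (basisVec k) * conv (w j) ρ x +
        cutoff Ω ε ρ x * conv (w j) (fun z => fderiv ℝ ρ z (basisVec k)) x) := by
  have hη := contDiff_cutoff (Ω := Ω) hρ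
  have hηj := contDiff_fderiv_apply hη (basisVec j)
  have hV := contDiff_conv hf.locallyIntegrable hρ.contDiff hρ.hasCompactSupport
  have hW := contDiff_conv (hf.integrable j).locallyIntegrable hρ.contDiff hρ.hasCompactSupport
  simp_rw [fderiv_cutoffField hf hρ]
  rw [← (hf.weakPartial k).fderiv_conv hρ.contDiff hρ.hasCompactSupport,
    ← fderiv_conv (hf.integrable j).locallyIntegrable hρ.contDiff hρ.hasCompactSupport,
    ← fderiv_mul_apply' hηj hV, ← fderiv_mul_apply' hη hW,
    fderiv_fun_add ((hηj.mul hV).differentiable (by simp) x)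
      ((hη.mul hW).differentiable (by simp) x)]
  rfl

/-- A point of the layer is within `3ε` of some `z` outside `closure Ω`, and the kernel reaches `ε`
further: this is the `4ε`. -/
theorem abs_conv_le_of_mem_boundaryLayer (hΩ : HasC11Boundary Ω)
    (hf : IsLipschitzField Ω B f w) (hρ : IsMollifier C ε ρ) {x : E n}
    (hx : x ∈ boundaryLayer Ω (3 * ε)) : |conv f ρ x| ≤ n * B * (4 * ε) := by
  obtain ⟨y, hy, hxy⟩ := Metric.mem_thickening_iff.1 (boundaryLayer_subset _ hx)
  -- The strict slack in `dist x y < 3ε` pays for replacing the boundary point `y` by a nearby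
  -- exterior point.
  obtain ⟨z, hz, hyz⟩ := Metric.mem_closure_iff.1 (hΩ.frontier_subset hy) (3 * ε - dist x y)
    (by linarith)
  have hB := hf.nonneg
  have := abs_conv_le (f := f) (B := n * B * (4 * ε)) (x := x) hρ.contDiff.continuous
    hρ.hasCompactSupport hρ.eq_zero (by
      filter_upwards [hf.abs_le_dist] with t ht htx
      refine (ht z hz).trans ?_
      gcongr
      linarith [dist_triangle t x z, dist_triangle x y z, Metric.mem_ball.1 htx])
  rwa [hρ.integral_abs, mul_one] at this

theorem abs_conv_partial_le (hf : IsLipschitzField Ω B f w) (hρ : IsMollifier C ε ρ) (x : E n)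
    (j : Fin n) : |conv (w j) ρ x| ≤ B := by
  have := abs_conv_le (f := w j) (B := B) (x := x) hρ.contDiff.continuous
    hρ.hasCompactSupport hρ.eq_zero (by filter_upwards [hf.bound j] with t ht _ using ht)
  rwa [hρ.integral_abs, mul_one] at this

/-- In the layer, the factor `C/ε` from the cutoff gradient meets the `O(ε)` bound on the mollified
field, and `|η - 1| ≤ 2` multiplies the bounded mollified gradient. Elsewhere only the mollification
error remains. -/
theorem abs_fderiv_cutoffField_sub_le (hΩ : HasC11Boundary Ω) (hf : IsLipschitzField Ω B f w)
    (hC : 0 ≤ C) (hε : 0 < ε) (hρ : IsMollifier C ε ρ) {x : E n} (hx : x ∈ Ω) (j : Fin n) :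
    |fderiv ℝ (cutoffField Ω ε ρ f) x (basisVec j) - w j x| ≤ |conv (w j) ρ x - w j x| +
      (boundaryLayer Ω (3 * ε)).indicator (fun _ => 4 * n * B * C + 2 * B) x := by
  rw [fderiv_cutoffField hf hρ]
  have hB := hf.nonneg
  by_cases hN : x ∈ Metric.thickening (3 * ε) Ωᶜ
  · have hL : x ∈ boundaryLayer Ω (3 * ε) := ⟨hN, hx⟩
    rw [indicator_of_mem hL]
    have e : fderiv ℝ (cutoff Ω ε ρ) x (basisVec j) * conv f ρ x +
        cutoff Ω ε ρ x * conv (w j) ρ x - w j x = (conv (w j) ρ x - w j x) +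
        (fderiv ℝ (cutoff Ω ε ρ) x (basisVec j) * conv f ρ x +
          (cutoff Ω ε ρ x - 1) * conv (w j) ρ x) := by ring
    rw [e]
    refine (abs_add_le _ _).trans (add_le_add le_rfl ((abs_add_le _ _).trans (add_le_add ?_ ?_)))
    · rw [abs_mul]
      calc _ ≤ C / ε * (n * B * (4 * ε)) := by
            gcongr
            · exact abs_fderiv_cutoff_le hρ x (norm_basisVec j).le
            · exact abs_conv_le_of_mem_boundaryLayer hΩ hf hρ hL
        _ = _ := by field_simp
    · rw [abs_mul]
      have h1 := abs_le.1 (abs_cutoff_le (Ω := Ω) hρ x)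
      gcongr
      · rw [abs_le]; constructor <;> linarith
      · exact abs_conv_partial_le hf hρ x j
  · rw [fderiv_cutoff_eq_zero hρ hN, cutoff_eq_one hρ hN, indicator_of_notMem (fun h => hN h.1)]
    simp

/-- Every term that differentiates the cutoff is `O(1/ε)`: either `ε⁻²` times a field of size
`O(ε)`, or `ε⁻¹` times a bounded gradient. The remaining term is `η` times `w j * ∂ₖρ`, with `|η| ≤
1`. -/
theorem abs_fderiv_fderiv_cutoffField_le (hΩ : HasC11Boundary Ω)
    (hf : IsLipschitzField Ω B f w) (hC : 0 ≤ C) (hε : 0 < ε) (hρ : IsMollifier C ε ρ)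
    {x : E n} (hx : x ∈ Ω) (j k : Fin n) :
    |fderiv ℝ (fun y => fderiv ℝ (cutoffField Ω ε ρ f) y (basisVec j)) x (basisVec k)| ≤
      |conv (w j) (fun z => fderiv ℝ ρ z (basisVec k)) x| +
      (boundaryLayer Ω (3 * ε)).indicator (fun _ => (4 * n * B * C + 2 * B * C) / ε) x := by
  rw [fderiv_fderiv_cutoffField hf hρ]
  have hB := hf.nonneg
  have hj := (norm_basisVec j).le
  have hk := (norm_basisVec k).le
  by_cases hN : x ∈ Metric.thickening (3 * ε) Ωᶜ
  · have hL : x ∈ boundaryLayer Ω (3 * ε) := ⟨hN, hx⟩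
    rw [indicator_of_mem hL]
    have h1 : |fderiv ℝ (fun y => fderiv ℝ (cutoff Ω ε ρ) y (basisVec j)) x (basisVec k) *
        conv f ρ x| ≤ 4 * n * B * C / ε := by
      rw [abs_mul]
      calc _ ≤ C / ε ^ 2 * (n * B * (4 * ε)) := by
            gcongr
            · exact abs_fderiv_fderiv_cutoff_le hρ x hj hk
            · exact abs_conv_le_of_mem_boundaryLayer hΩ hf hρ hL
        _ = _ := by field_simp
    have h2 : ∀ i l, |fderiv ℝ (cutoff Ω ε ρ) x (basisVec i) * conv (w l) ρ x| ≤ B * C / ε := by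
      intro i l
      rw [abs_mul]
      calc _ ≤ C / ε * B := by
            gcongr
            · exact abs_fderiv_cutoff_le hρ x (norm_basisVec i).le
            · exact abs_conv_partial_le hf hρ x l
        _ = _ := by ring
    have h3 : |cutoff Ω ε ρ x * conv (w j) (fun z => fderiv ℝ ρ z (basisVec k)) x| ≤
        |conv (w j) (fun z => fderiv ℝ ρ z (basisVec k)) x| := by
      rw [abs_mul]
      exact mul_le_of_le_one_left (abs_nonneg _) (abs_cutoff_le hρ x)
    have e : (4 * n * B * C + 2 * B * C) / ε =
        4 * n * B * C / ε + B * C / ε + B * C / ε := by ring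
    rw [e]
    refine (abs_add_le _ _).trans ?_
    linarith [abs_add_le (fderiv ℝ (fun y => fderiv ℝ (cutoff Ω ε ρ) y (basisVec j)) x
      (basisVec k) * conv f ρ x) (fderiv ℝ (cutoff Ω ε ρ) x (basisVec j) * conv (w k) ρ x),
      abs_add_le (fderiv ℝ (cutoff Ω ε ρ) x (basisVec k) * conv (w j) ρ x) (cutoff Ω ε ρ x *
      conv (w j) (fun z => fderiv ℝ ρ z (basisVec k)) x), h2 j k, h2 k j]
  · rw [fderiv_cutoff_eq_zero hρ hN, fderiv_cutoff_eq_zero hρ hN,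
      fderiv_fderiv_cutoff_eq_zero hρ hN, cutoff_eq_one hρ hN,
      indicator_of_notMem (fun h => hN h.1)]
    simp

theorem setLIntegral_sq_le (hΩ : MeasurableSet Ω) {N : Set (E n)} (hN : MeasurableSet N)
    {p q : E n → ℝ} {K : ℝ} (h : ∀ x ∈ Ω, |p x| ≤ |q x| + N.indicator (fun _ => K) x) :
    ∫⁻ x in Ω, ENNReal.ofReal (p x ^ 2) ≤
      2 * (∫⁻ x, ENNReal.ofReal (q x ^ 2)) + ENNReal.ofReal (2 * K ^ 2) * volume N := by
  calc ∫⁻ x in Ω, ENNReal.ofReal (p x ^ 2)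
      ≤ ∫⁻ x in Ω, (2 * ENNReal.ofReal (q x ^ 2) +
          N.indicator (fun _ => ENNReal.ofReal (2 * K ^ 2)) x) := by
        refine setLIntegral_mono' hΩ fun x hx => ?_
        have hsq : p x ^ 2 ≤ 2 * q x ^ 2 + 2 * N.indicator (fun _ => K) x ^ 2 := by
          have h1 : |p x| ^ 2 ≤ (|q x| + N.indicator (fun _ => K) x) ^ 2 := by
            gcongr; exact h x hx
          rw [sq_abs] at h1
          nlinarith [sq_nonneg (|q x| - N.indicator (fun _ => K) x), sq_abs (q x)]
        refine (ENNReal.ofReal_le_ofReal hsq).trans ?_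
        rw [ENNReal.ofReal_add (by positivity) (by positivity), ENNReal.ofReal_mul (by norm_num)]
        refine add_le_add (by simp) (le_of_eq ?_)
        by_cases hxN : x ∈ N <;> simp [hxN]
    _ ≤ ∫⁻ x, (2 * ENNReal.ofReal (q x ^ 2) +
          N.indicator (fun _ => ENNReal.ofReal (2 * K ^ 2)) x) := setLIntegral_le_lintegral _ _
    _ = _ := by
        rw [lintegral_add_right _ (measurable_const.indicator hN),
          lintegral_const_mul' _ _ (by simp), lintegral_indicator_const hN]

end CutoffField

/-! ### Energy of the competitor. -/

section EnergyBound

variable {n : ℕ}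

theorem frobenius_norm_sq (A : Mat n) : ‖A‖ ^ 2 = ∑ i, ∑ j, A i j ^ 2 := by
  rw [Matrix.frobenius_norm_def, ← Real.rpow_mul_natCast (by positivity)]
  simp

theorem abs_entry_le_norm (A : Mat n) (i j : Fin n) : |A i j| ≤ ‖A‖ := by
  refine abs_le_of_sq_le_sq ?_ (norm_nonneg A)
  rw [frobenius_norm_sq]
  calc A i j ^ 2 ≤ ∑ j, A i j ^ 2 :=
        Finset.single_le_sum (f := fun j => A i j ^ 2) (fun _ _ => sq_nonneg _) (Finset.mem_univ j)
    _ ≤ _ := Finset.single_le_sum (f := fun i => ∑ j, A i j ^ 2)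
        (fun _ _ => Finset.sum_nonneg fun _ _ => sq_nonneg _) (Finset.mem_univ i)

theorem edist_sq (A A' : Mat n) :
    edist A A' ^ 2 = ∑ i, ∑ j, ENNReal.ofReal ((A i j - A' i j) ^ 2) := by
  rw [edist_dist, dist_eq_norm, ← ENNReal.ofReal_pow (norm_nonneg _), frobenius_norm_sq]
  change ENNReal.ofReal (∑ i, ∑ j, (A i j - A' i j) ^ 2) = _
  rw [ENNReal.ofReal_sum_of_nonneg fun i _ => Finset.sum_nonneg fun j _ => sq_nonneg _]
  refine Finset.sum_congr rfl fun i _ => ?_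
  rw [ENNReal.ofReal_sum_of_nonneg fun j _ => sq_nonneg _]

theorem two_mul_ofReal_add {a b c d : ℝ} (ha : 0 ≤ a) (hb : 0 ≤ b) (hc : 0 ≤ c) (hd : 0 ≤ d) :
    2 * (ENNReal.ofReal a * ENNReal.ofReal b) + ENNReal.ofReal c * ENNReal.ofReal d =
      ENNReal.ofReal (2 * (a * b) + c * d) := by
  rw [ENNReal.ofReal_add (by positivity) (by positivity), ENNReal.ofReal_mul (by norm_num),
    ENNReal.ofReal_mul ha, ENNReal.ofReal_mul hc]
  simp

theorem minEnergy_le_energy {Ω : Set (E n)} {K : Set (Mat n)} {M : Mat n} {u : E n → E n}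
    {G : E n → Mat n} {H : E n → Fin n → Fin n → Fin n → ℝ} (h : IsCompetitor Ω M u G H)
    (ε : ℝ) : minEnergy Ω K M ε ≤ energy Ω K ε G H :=
  iInf_le_of_le u <| iInf_le_of_le G <| iInf_le_of_le H <| iInf_le_of_le h le_rfl

variable {Ω : Set (E n)} {B C D J ε s : ℝ} {ρ f : E n → ℝ} {w : Fin n → E n → ℝ}

/-- This is where `s ≤ 1/2` is needed: the boundary contribution of order `ε` must not exceed
`ε^{2s}`. -/
theorem le_rpow_two_mul (hε : 0 < ε) (hε1 : ε ≤ 1) (hs : s ≤ 1 / 2) : ε ≤ ε ^ (2 * s) := by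
  simpa using Real.rpow_le_rpow_of_exponent_ge hε hε1 (by linarith : 2 * s ≤ 1)

theorem volume_boundaryLayer_le
    (hD : volume (Metric.thickening (3 * ε) (frontier Ω)) ≤ ENNReal.ofReal (D * (3 * ε))) :
    volume (boundaryLayer Ω (3 * ε)) ≤ ENNReal.ofReal (D * (3 * ε)) :=
  (measure_mono (boundaryLayer_subset _)).trans hD

theorem measurableSet_boundaryLayer (hΩo : IsOpen Ω) (δ : ℝ) :
    MeasurableSet (boundaryLayer Ω δ) :=
  Metric.isOpen_thickening.measurableSet.inter hΩo.measurableSet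

theorem setLIntegral_fderiv_cutoffField_sub_sq_le (hΩo : IsOpen Ω) (hΩ : HasC11Boundary Ω)
    (hf : IsLipschitzField Ω B f w) (hC : 0 ≤ C) (hε : 0 < ε) (hε1 : ε ≤ 1)
    (hρ : IsMollifier C ε ρ) (hs : 0 ≤ s) (hs2 : s ≤ 1 / 2) (hJ : 0 ≤ J) (hD0 : 0 ≤ D) (j : Fin n)
    (hwJ : sobolevSq s (w j) ≤ ENNReal.ofReal J)
    (hD : volume (Metric.thickening (3 * ε) (frontier Ω)) ≤ ENNReal.ofReal (D * (3 * ε))) :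
    ∫⁻ x in Ω, ENNReal.ofReal ((fderiv ℝ (cutoffField Ω ε ρ f) x (basisVec j) - w j x) ^ 2) ≤
      ENNReal.ofReal ((2 * (2 * Real.pi) ^ 2 * J + 6 * (4 * n * B * C + 2 * B) ^ 2 * D) *
        ε ^ (2 * s)) := by
  refine (setLIntegral_sq_le hΩo.measurableSet (measurableSet_boundaryLayer hΩo _)
    fun x hx => abs_fderiv_cutoffField_sub_le hΩ hf hC hε hρ hx j).trans ?_
  have h1 := lintegral_conv_sub_sq_le hs (by linarith) hε hρ (hf.integrable j) (hf.bound j)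
  calc _ ≤ 2 * (ENNReal.ofReal ((2 * Real.pi) ^ 2 * ε ^ (2 * s)) * ENNReal.ofReal J) +
        ENNReal.ofReal (2 * (4 * n * B * C + 2 * B) ^ 2) * ENNReal.ofReal (D * (3 * ε)) := by
        gcongr
        · exact h1.trans (by gcongr)
        · exact volume_boundaryLayer_le hD
    _ = ENNReal.ofReal (2 * ((2 * Real.pi) ^ 2 * ε ^ (2 * s) * J) +
        2 * (4 * n * B * C + 2 * B) ^ 2 * (D * (3 * ε))) := by
        exact two_mul_ofReal_add (by positivity) hJ (by positivity) (by positivity)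
    _ ≤ _ := by
        apply ENNReal.ofReal_le_ofReal
        have h2 := mul_le_mul_of_nonneg_left (le_rpow_two_mul hε hε1 hs2)
          (by positivity : 0 ≤ 6 * (4 * n * B * C + 2 * B) ^ 2 * D)
        linarith

theorem setLIntegral_fderiv_fderiv_cutoffField_sq_le (hΩo : IsOpen Ω) (hΩ : HasC11Boundary Ω)
    (hf : IsLipschitzField Ω B f w) (hC : 0 ≤ C) (hε : 0 < ε) (hε1 : ε ≤ 1)
    (hρ : IsMollifier C ε ρ) (hs : 0 ≤ s) (hs2 : s ≤ 1 / 2) (hJ : 0 ≤ J) (hD0 : 0 ≤ D)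
    (j k : Fin n) (hwJ : sobolevSq s (w j) ≤ ENNReal.ofReal J)
    (hD : volume (Metric.thickening (3 * ε) (frontier Ω)) ≤ ENNReal.ofReal (D * (3 * ε))) :
    ENNReal.ofReal (ε ^ 2) * ∫⁻ x in Ω, ENNReal.ofReal
      (fderiv ℝ (fun y => fderiv ℝ (cutoffField Ω ε ρ f) y (basisVec j)) x (basisVec k) ^ 2) ≤
      ENNReal.ofReal ((2 * (2 * Real.pi * C) ^ 2 * J +
        6 * (4 * n * B * C + 2 * B * C) ^ 2 * D) * ε ^ (2 * s)) := by
  have h0 := setLIntegral_sq_le hΩo.measurableSet (measurableSet_boundaryLayer hΩo _)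
    fun x hx => abs_fderiv_fderiv_cutoffField_le hΩ hf hC hε hρ hx j k
  have hI0 : 0 ≤ ∫ x, |fderiv ℝ ρ x (basisVec k)| := integral_nonneg fun _ => abs_nonneg _
  have h1 := lintegral_conv_sq_le (s := s) hs (by linarith) hε
    (contDiff_fderiv_apply hρ.contDiff (basisVec k)).continuous
    (hasCompactSupport_fderiv_apply hρ.hasCompactSupport (basisVec k))
    (hρ.fderiv_eq_zero (basisVec k))
    (integral_fderiv_eq_zero hρ.contDiff hρ.hasCompactSupport (basisVec k))
    (hf.integrable j) (hf.bound j)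
  -- The factor `(C/ε)²` from the kernel is compensated by the weight `ε²` of the second-gradient
  -- energy.
  have h2 : (2 * Real.pi * ∫ x, |fderiv ℝ ρ x (basisVec k)|) ^ 2 * ε ^ (2 * s) ≤
      (2 * Real.pi * (C / ε)) ^ 2 * ε ^ (2 * s) := by
    have := hρ.integral_fderiv (basisVec k) (norm_basisVec k).le
    gcongr
  calc _ ≤ ENNReal.ofReal (ε ^ 2) *
        (2 * (ENNReal.ofReal ((2 * Real.pi * (C / ε)) ^ 2 * ε ^ (2 * s)) * ENNReal.ofReal J) +
        ENNReal.ofReal (2 * ((4 * n * B * C + 2 * B * C) / ε) ^ 2) *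
          ENNReal.ofReal (D * (3 * ε))) := by
        refine mul_le_mul_right (h0.trans ?_) _
        gcongr
        · exact h1.trans (mul_le_mul' (ENNReal.ofReal_le_ofReal h2) hwJ)
        · exact volume_boundaryLayer_le hD
    _ = ENNReal.ofReal (ε ^ 2 * (2 * ((2 * Real.pi * (C / ε)) ^ 2 * ε ^ (2 * s) * J) +
        2 * ((4 * n * B * C + 2 * B * C) / ε) ^ 2 * (D * (3 * ε)))) := by
        rw [ENNReal.ofReal_mul (p := ε ^ 2) (by positivity),
          two_mul_ofReal_add (by positivity) hJ (by positivity) (by positivity)]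
    _ ≤ _ := by
        apply ENNReal.ofReal_le_ofReal
        have h2 := mul_le_mul_of_nonneg_left (le_rpow_two_mul hε hε1 hs2)
          (by positivity : 0 ≤ 6 * (4 * n * B * C + 2 * B * C) ^ 2 * D)
        have e : ε ^ 2 * (2 * ((2 * Real.pi * (C / ε)) ^ 2 * ε ^ (2 * s) * J) +
            2 * ((4 * n * B * C + 2 * B * C) / ε) ^ 2 * (D * (3 * ε))) =
            2 * (2 * Real.pi * C) ^ 2 * J * ε ^ (2 * s) +
            6 * (4 * n * B * C + 2 * B * C) ^ 2 * D * ε := by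
          field_simp
          ring
        rw [e]
        linarith

theorem contDiff_mulVec_apply (M : Mat n) (i : Fin n) :
    ContDiff ℝ ∞ fun x : E n => (M *ᵥ x.ofLp) i := by
  simp only [Matrix.mulVec, dotProduct]
  fun_prop

theorem fderiv_mulVec_apply (M : Mat n) (i j : Fin n) (x : E n) :
    fderiv ℝ (fun x : E n => (M *ᵥ x.ofLp) i) x (basisVec j) = M i j := by
  let L : E n →ₗ[ℝ] ℝ :=
    { toFun := fun x => (M *ᵥ x.ofLp) i
      map_add' := fun x y => by simp [Matrix.mulVec_add]
      map_smul' := fun c x => by simp [Matrix.mulVec_smul] }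
  have h : HasFDerivAt (fun x : E n => (M *ᵥ x.ofLp) i) (LinearMap.toContinuousLinearMap L) x :=
    (LinearMap.toContinuousLinearMap L).hasFDerivAt
  rw [h.fderiv]
  change (M *ᵥ (basisVec j).ofLp) i = M i j
  simp

/-- The competitor obtained by adding a linear map to cut-off mollified fields. -/
theorem isCompetitor_cutoffField {M : Mat n} {v : Fin n → E n → ℝ}
    {w : Fin n → Fin n → E n → ℝ} (hf : ∀ i, IsLipschitzField Ω B (v i) (w i)) (hε : 0 < ε)
    (hρ : IsMollifier C ε ρ) :
    IsCompetitor Ω M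
      (fun x => WithLp.toLp 2 fun i => cutoffField Ω ε ρ (v i) x + (M *ᵥ x.ofLp) i)
      (fun x => Matrix.of fun i j =>
        fderiv ℝ (cutoffField Ω ε ρ (v i)) x (basisVec j) + M i j)
      (fun x i j k =>
        fderiv ℝ (fun y => fderiv ℝ (cutoffField Ω ε ρ (v i)) y (basisVec j)) x
          (basisVec k)) := by
  have hF := fun i => contDiff_cutoffField (hf i) hρ
  refine ⟨fun i j => ?_, ?_, fun i j k => ?_⟩
  · have := (hasWeakPartialOn_of_contDiff (hF i) univ j).add_contDiff (contDiff_mulVec_apply M i)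
    simp only [fderiv_mulVec_apply] at this
    exact this
  · refine (ae_restrict_iff' isClosed_closure.measurableSet.compl).2 (.of_forall fun x hx => ?_)
    ext i j
    have h0 : cutoffField Ω ε ρ (v i) =ᶠ[nhds x] fun _ => 0 := by
      filter_upwards [isClosed_closure.isOpen_compl.mem_nhds hx] with y hy
      rw [cutoffField, cutoff_eq_zero hρ, zero_mul]
      exact Metric.self_subset_thickening hε _ fun h => hy (subset_closure h)
    simp [h0.fderiv_eq]
  · have := hasWeakPartialOn_of_contDiff
      ((contDiff_fderiv_apply (hF i) (basisVec j)).add (contDiff_const (c := M i j))) Ω k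
    simp only [fderiv_add_const] at this
    exact this

/-- The distance to `K` is estimated by the distance to one element of it, the gradient `w + M` of
the exact solution; the Frobenius norm then splits both energy terms into `n²` and `n³` scalar
integrals. -/
theorem minEnergy_le {K : Set (Mat n)} {M : Mat n} {v : Fin n → E n → ℝ}
    {w : Fin n → Fin n → E n → ℝ} {P Q : ℝ} (hf : ∀ i, IsLipschitzField Ω B (v i) (w i))
    (hε : 0 < ε) (hρ : IsMollifier C ε ρ)
    (hK : ∀ᵐ x ∂volume.restrict Ω, Matrix.of (fun i j => w i j x + M i j) ∈ K)
    (h1 : ∀ i j, ∫⁻ x in Ω, ENNReal.ofReal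
      ((fderiv ℝ (cutoffField Ω ε ρ (v i)) x (basisVec j) - w i j x) ^ 2) ≤ ENNReal.ofReal P)
    (h2 : ∀ i j k, ENNReal.ofReal (ε ^ 2) * ∫⁻ x in Ω, ENNReal.ofReal
      (fderiv ℝ (fun y => fderiv ℝ (cutoffField Ω ε ρ (v i)) y (basisVec j)) x (basisVec k) ^ 2)
        ≤ ENNReal.ofReal Q) :
    minEnergy Ω K M ε ≤ (n * n : ℕ) * ENNReal.ofReal P + (n * n * n : ℕ) * ENNReal.ofReal Q := by
  have hm : ∀ i j, AEMeasurable (fun x => ENNReal.ofReal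
      ((fderiv ℝ (cutoffField Ω ε ρ (v i)) x (basisVec j) - w i j x) ^ 2))
      (volume.restrict Ω) := fun i j => by
    have ha := (contDiff_fderiv_apply (contDiff_cutoffField (hf i) hρ)
      (basisVec j)).continuous.aemeasurable (μ := volume)
    have hb := ((hf i).integrable j).aestronglyMeasurable.aemeasurable
    exact (((ha.sub hb).pow_const 2).ennreal_ofReal).restrict
  have hm2 : ∀ i j k, AEMeasurable (fun x => ENNReal.ofReal
      (fderiv ℝ (fun y => fderiv ℝ (cutoffField Ω ε ρ (v i)) y (basisVec j)) x (basisVec k) ^ 2))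
      (volume.restrict Ω) := fun i j k => by
    have ha := (contDiff_fderiv_apply (contDiff_fderiv_apply (contDiff_cutoffField (hf i) hρ)
      (basisVec j)) (basisVec k)).continuous.aemeasurable (μ := volume.restrict Ω)
    exact (ha.pow_const 2).ennreal_ofReal
  refine (minEnergy_le_energy (isCompetitor_cutoffField (M := M) hf hε hρ) ε).trans ?_
  refine add_le_add ?_ ?_
  · calc _ ≤ ∫⁻ x in Ω, ∑ i, ∑ j, ENNReal.ofReal
          ((fderiv ℝ (cutoffField Ω ε ρ (v i)) x (basisVec j) - w i j x) ^ 2) := by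
          refine lintegral_mono_ae ?_
          filter_upwards [hK] with x hx
          refine (pow_le_pow_left' (Metric.infEDist_le_edist_of_mem hx) 2).trans ?_
          rw [edist_sq]
          simp
      _ = ∑ i, ∑ j, ∫⁻ x in Ω, ENNReal.ofReal
          ((fderiv ℝ (cutoffField Ω ε ρ (v i)) x (basisVec j) - w i j x) ^ 2) := by
          rw [lintegral_finsetSum' _ fun i _ => Finset.aemeasurable_fun_sum _ fun j _ => hm i j]
          exact Finset.sum_congr rfl fun i _ => lintegral_finsetSum' _ fun j _ => hm i j
      _ ≤ ∑ _i : Fin n, ∑ _j : Fin n, ENNReal.ofReal P :=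
          Finset.sum_le_sum fun i _ => Finset.sum_le_sum fun j _ => h1 i j
      _ = _ := by simp [mul_assoc]
  · rw [lintegral_finsetSum' _ fun i _ => Finset.aemeasurable_fun_sum _ fun j _ =>
      Finset.aemeasurable_fun_sum _ fun k _ => hm2 i j k, Finset.mul_sum]
    calc _ ≤ ∑ _i : Fin n, ∑ _j : Fin n, ∑ _k : Fin n, ENNReal.ofReal Q := by
          refine Finset.sum_le_sum fun i _ => ?_
          rw [lintegral_finsetSum' _ fun j _ => Finset.aemeasurable_fun_sum _ fun k _ => hm2 i j k,
            Finset.mul_sum]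
          refine Finset.sum_le_sum fun j _ => ?_
          rw [lintegral_finsetSum' _ fun k _ => hm2 i j k, Finset.mul_sum]
          exact Finset.sum_le_sum fun k _ => h2 i j k
      _ = _ := by simp [mul_assoc]

end EnergyBound

/-! ### The upper energy bound and the comparison of exponents. -/

section MainTheorem

variable {n : ℕ}

theorem MemHs.mono {r t : ℝ} (h : r ≤ t) {v : E n → E n} (hv : MemHs t v) : MemHs r v :=
  ⟨hv.1, fun i => (hv.2 i).imp fun _ hT => ⟨hT.1, hT.2.mono h⟩⟩

theorem exists_ae_abs_entry_le {G : E n → Mat n} (hG : MemLp G ⊤ volume) :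
    ∃ B : ℝ, 0 ≤ B ∧ ∀ i j, ∀ᵐ x, |G x i j| ≤ B := by
  refine ⟨(eLpNorm G ⊤ volume).toReal, ENNReal.toReal_nonneg, fun i j => ?_⟩
  have h : ∀ᵐ x, ‖G x‖ₑ ≤ eLpNorm G ⊤ volume := by
    rw [eLpNorm_exponent_top]; exact ae_le_eLpNormEssSup
  filter_upwards [h] with x hx
  refine (abs_entry_le_norm _ i j).trans ?_
  have := ENNReal.toReal_mono hG.2.ne hx
  rwa [toReal_enorm] at this

/-- Subtracting an affine map changes the weak gradient by its linear part. -/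
theorem HasWeakGradientOn.shifted_ae_eq {u : E n → E n} {Du Dv : E n → Mat n} {M : Mat n}
    {b : E n} (hDu : HasWeakGradientOn univ u Du)
    (hDv : HasWeakGradientOn univ (shifted u M b) Dv) (i j : Fin n) :
    ∀ᵐ x, Dv x i j = Du x i j - M i j := by
  have ha : ContDiff ℝ ∞ fun x : E n => -((M *ᵥ x.ofLp) i) - b i :=
    (contDiff_mulVec_apply M i).neg.sub contDiff_const
  have h := (hDu i j).add_contDiff ha
  have e1 : (fun x => u x i + (-((M *ᵥ x.ofLp) i) - b i)) = fun x => shifted u M b x i := by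
    ext x
    simp only [shifted, PiLp.sub_apply]
    ring
  have e2 : ∀ x, fderiv ℝ (fun x : E n => -((M *ᵥ x.ofLp) i) - b i) x (basisVec j) = -M i j := by
    intro x
    rw [fderiv_sub_const, fderiv_fun_neg, neg_apply, fderiv_mulVec_apply]
  rw [e1] at h
  simp only [e2] at h
  filter_upwards [(hDv i j).ae_eq h] with x hx
  rw [hx]; ring

theorem integrable_of_ae_eq_zero {S : Set (E n)} (hS : IsCompact S) {f : E n → ℝ}
    (hf : LocallyIntegrable f) (h0 : ∀ᵐ x, x ∈ Sᶜ → f x = 0) : Integrable f := by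
  have h1 : Integrable (S.indicator f) :=
    (integrable_indicator_iff hS.measurableSet).2 (hf.integrableOn_isCompact hS)
  refine h1.congr ?_
  filter_upwards [h0] with x hx
  by_cases hxS : x ∈ S
  · simp [hxS]
  · simp [hxS, hx hxS]

/-- Dividing by `ε^{2μ}` would give `1 ≤ A ε^{2(s-μ)}`, whose right side tends to zero. -/
theorem not_forall_rpow_le_mul_rpow {μ s A ε₁ : ℝ} (h : μ < s) (hε₁ : 0 < ε₁) :
    ¬ ∀ ε ∈ Ioo 0 ε₁, ε ^ (2 * μ) ≤ A * ε ^ (2 * s) := by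
  intro hall
  have hlim : Filter.Tendsto (fun ε : ℝ => A * ε ^ (2 * (s - μ))) (nhdsWithin 0 (Ioi 0))
      (nhds 0) := by
    have hc : ContinuousAt (fun ε : ℝ => ε ^ (2 * (s - μ))) 0 :=
      Real.continuousAt_rpow_const _ _ (Or.inr (by linarith))
    have h1 := (hc.tendsto.mono_left (nhdsWithin_le_nhds (s := Ioi 0))).const_mul A
    rwa [Real.zero_rpow (by linarith), mul_zero] at h1
  obtain ⟨ε, hε, hε1⟩ := ((hlim.eventually (gt_mem_nhds one_pos)).and
    (Ioo_mem_nhdsGT hε₁)).exists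
  have h1 := hall ε hε1
  have hpos := hε1.1
  have e : ε ^ (2 * s) = ε ^ (2 * (s - μ)) * ε ^ (2 * μ) := by
    rw [← Real.rpow_add hpos]; congr 1; ring
  rw [e, ← mul_assoc] at h1
  have := Real.rpow_pos_of_pos hpos (2 * μ)
  nlinarith

theorem natCast_mul_ofReal_add (k l : ℕ) {p q r : ℝ} (hp : 0 ≤ p) (hq : 0 ≤ q) (hr : 0 ≤ r) :
    k * ENNReal.ofReal (p * r) + l * ENNReal.ofReal (q * r) =
      ENNReal.ofReal ((k * p + l * q) * r) := by
  rw [add_mul, ENNReal.ofReal_add (by positivity) (by positivity), mul_assoc, mul_assoc,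
    ENNReal.ofReal_mul (p := (k : ℝ)) (by positivity),
    ENNReal.ofReal_mul (p := (l : ℝ)) (by positivity),
    ENNReal.ofReal_natCast, ENNReal.ofReal_natCast]

/-- A solution of the inclusion with fractional regularity `s ≤ 1 / 2` bounds the minimal
energy by `ε^{2s}`. -/
theorem exists_minEnergy_le {Ω : Set (E n)} (hΩo : IsOpen Ω) (hΩb : Bornology.IsBounded Ω)
    (hΩ : HasC11Boundary Ω) {K : Set (Mat n)} {M : Mat n} {u : E n → E n} {Du : E n → Mat n}
    (hDu : HasWeakGradientOn univ u Du) (hin : ∀ᵐ x ∂volume.restrict Ω, Du x ∈ K)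
    (hout : ∀ᵐ x ∂volume.restrict (closure Ω)ᶜ, Du x = M) {b : E n} {s : ℝ} (hs : 0 ≤ s)
    (hs2 : s ≤ 1 / 2) (hHs : MemHs (1 + s) (shifted u M b))
    (hsupp : ∀ᵐ x ∂volume.restrict (closure Ω)ᶜ, shifted u M b x = 0) {Dv : E n → Mat n}
    (hDv : HasWeakGradientOn univ (shifted u M b) Dv) (hDvb : MemLp Dv ⊤ volume) :
    ∃ A : ℝ, 0 ≤ A ∧ ∃ ε₁ : ℝ, 0 < ε₁ ∧ ∀ ε ∈ Ioo 0 ε₁,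
      minEnergy Ω K M ε ≤ ENNReal.ofReal (A * ε ^ (2 * s)) := by
  obtain ⟨B, hB, hbound⟩ := exists_ae_abs_entry_le hDvb
  obtain ⟨C, hC, hmoll⟩ := exists_isMollifier (E n)
  obtain ⟨D, hD, δ₀, hδ₀, hlayer⟩ := hΩ.volume_thickening_le hΩb
  have hcpt : IsCompact (closure Ω) := hΩb.isCompact_closure
  have hrel : ∀ᵐ x, ∀ i j, Dv x i j = Du x i j - M i j := by
    simp only [ae_all_iff]; exact hDu.shifted_ae_eq hDv
  have hint : ∀ i j, Integrable fun x => Dv x i j := fun i j => by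
    refine integrable_of_ae_eq_zero hcpt (locallyIntegrable_of_univ (hDv i j).2.1) ?_
    rw [ae_restrict_iff' isClosed_closure.measurableSet.compl] at hout
    filter_upwards [hout, hrel] with x hx hx2 hxS
    rw [hx2, hx hxS, sub_self]
  have hfield : ∀ i, IsLipschitzField Ω B (fun x => shifted u M b x i)
      (fun j x => Dv x i j) := fun i =>
    -- Any weak partial derivative records the local integrability of the function itself; the
    -- direction `i` is merely an available index.
    have hloc : LocallyIntegrable fun x => shifted u M b x i :=
      locallyIntegrable_of_univ (hDv i i).1
    { nonneg := hB
      weakPartial := hDv i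
      bound := hbound i
      integrable := hint i
      locallyIntegrable := hloc
      abs_le_dist := ae_abs_le_dist (hDv i) hB (hbound i) isClosed_closure
        (by filter_upwards [hsupp] with x hx; simp [hx]) hloc }
  have hfin : ∀ i j, sobolevSq s (fun x => Dv x i j) < ⊤ := fun i j => by
    obtain ⟨T, hT, hTs⟩ := hHs.2 i
    exact sobolevSq_lt_top_of_hasWeakPartialOn hs (hDv i j) (hint i j) (hbound i j) hTs hT
  set J : ℝ := ∑ i, ∑ j, (sobolevSq s fun x => Dv x i j).toReal
  have hJ : 0 ≤ J := by positivity
  have hle : ∀ i j, sobolevSq s (fun x => Dv x i j) ≤ ENNReal.ofReal J := fun i j => by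
    rw [ENNReal.le_ofReal_iff_toReal_le (hfin i j).ne hJ]
    calc _ ≤ ∑ j, (sobolevSq s fun x => Dv x i j).toReal :=
          Finset.single_le_sum (f := fun j => (sobolevSq s fun x => Dv x i j).toReal)
            (fun _ _ => ENNReal.toReal_nonneg) (Finset.mem_univ j)
      _ ≤ _ := Finset.single_le_sum
          (f := fun i => ∑ j, (sobolevSq s fun x => Dv x i j).toReal)
          (fun _ _ => Finset.sum_nonneg fun _ _ => ENNReal.toReal_nonneg) (Finset.mem_univ i)
  have hK : ∀ᵐ x ∂volume.restrict Ω, Matrix.of (fun i j => Dv x i j + M i j) ∈ K := by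
    filter_upwards [hin, ae_restrict_of_ae hrel] with x hx hx2
    convert hx using 1
    ext i j
    simp [hx2]
  set P := 2 * (2 * Real.pi) ^ 2 * J + 6 * (4 * n * B * C + 2 * B) ^ 2 * D
  set Q := 2 * (2 * Real.pi * C) ^ 2 * J + 6 * (4 * n * B * C + 2 * B * C) ^ 2 * D
  have hP : 0 ≤ P := by positivity
  have hQ : 0 ≤ Q := by positivity
  -- The bound `1` is for `ε ≤ ε^{2s}`; `δ₀ / 3` makes the volume estimate applicable to the layer
  -- of width `3ε`.
  refine ⟨(n * n : ℕ) * P + (n * n * n : ℕ) * Q, by positivity, min 1 (δ₀ / 3), by positivity,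
    fun ε hε => ?_⟩
  have hε0 := hε.1
  have hε1 : ε ≤ 1 := hε.2.le.trans (min_le_left _ _)
  have hε3 : 3 * ε < δ₀ := by linarith [hε.2.trans_le (min_le_right _ _)]
  obtain ⟨ρ, hρ⟩ := hmoll ε hε0
  have hvol := hlayer (3 * ε) ⟨by positivity, hε3⟩
  refine (minEnergy_le hfield hε0 hρ hK
    (fun i j => setLIntegral_fderiv_cutoffField_sub_sq_le hΩo hΩ (hfield i) hC hε0 hε1 hρ hs hs2
      hJ hD j (hle i j) hvol)
    (fun i j k => setLIntegral_fderiv_fderiv_cutoffField_sq_le hΩo hΩ (hfield i) hC hε0 hε1 hρ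
      hs hs2 hJ hD j k (hle i j) hvol)).trans (le_of_eq ?_)
  exact natCast_mul_ofReal_add _ _ hP hQ (by positivity)

end MainTheorem

end Wells

end

theorem theorem1 {n m : ℕ} (Ω : Set (Wells.E n)) (hΩo : IsOpen Ω)
    (hΩb : Bornology.IsBounded Ω) (hΩ : Wells.HasC11Boundary Ω)
    (α : ℝ≥0 → ℝ≥0) (U : Fin m → ℝ≥0 → Wells.Mat n) (hU : ∀ j t, (U j t).IsSymm)
    (θc θ : ℝ≥0) (M : Wells.Mat n)
    (C μ ε₀ : ℝ) (hC : 1 < C) (hμ : μ ∈ Ioo (0 : ℝ) (1 / 2)) (hε₀ : 0 < ε₀)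
    (hE : ∀ ε ∈ Ioo (0 : ℝ) ε₀, ENNReal.ofReal (ε ^ (2 * μ)) ≤
      ENNReal.ofReal C * Wells.minEnergy Ω (Wells.wells α U θc θ) M ε)
    (u : Wells.E n → Wells.E n) (Du : Wells.E n → Wells.Mat n)
    (hDu : Wells.HasWeakGradientOn univ u Du)
    (hin : ∀ᵐ x ∂volume.restrict Ω, Du x ∈ Wells.wells α U θc θ)
    (hout : ∀ᵐ x ∂volume.restrict (closure Ω)ᶜ, Du x = M)
    (b : Wells.E n) (s : ℝ)
    (hHs : Wells.MemHs (1 + s) (Wells.shifted u M b))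
    (hsupp : ∀ᵐ x ∂volume.restrict (closure Ω)ᶜ, Wells.shifted u M b x = 0)
    (Dv : Wells.E n → Wells.Mat n)
    (hDv : Wells.HasWeakGradientOn univ (Wells.shifted u M b) Dv)
    (hDvb : MemLp Dv ∞ volume) :
    s ≤ μ := by
  by_contra hlt
  push Not at hlt
  -- Truncating at `1/2` makes the upper energy bound available, and `μ < 1/2` keeps the exponent
  -- strictly above `μ`.
  have hs' : μ < min s (1 / 2) := lt_min hlt hμ.2
  obtain ⟨A, hA, ε₁, hε₁, hmin⟩ := Wells.exists_minEnergy_le hΩo hΩb hΩ hDu hin hout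
    (hμ.1.trans hs').le (min_le_right s (1 / 2))
    (hHs.mono (by linarith [min_le_left s (1 / 2)])) hsupp hDv hDvb
  refine Wells.not_forall_rpow_le_mul_rpow (A := C * A) hs' (lt_min hε₀ hε₁) fun ε hε => ?_
  have hε0 := hε.1
  have h := (hE ε ⟨hε.1, hε.2.trans_le (min_le_left _ _)⟩).trans
    (mul_le_mul_right (hmin ε ⟨hε.1, hε.2.trans_le (min_le_right _ _)⟩) _)
  rw [← ENNReal.ofReal_mul (by linarith), ENNReal.ofReal_le_ofReal_iff (by positivity)] at h
  linarith
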